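/- Let $M$ be a smooth Riemannian manifold with a filtration $0=H^0\subseteq H^1\subseteq\dots\subseteq H^n=TM$ of its tangent bundle by smooth subbundles such that $[\Gamma(H^i),\Gamma(H^j)]\subseteq\Gamma(H^{i+j})$ (with $H^i=TM$ for $i>n$). For $x\in M$ let $\mathfrak n=gr(H)_x=\bigoplus_i H^i_x/H^{i-1}_x$ be the osculating Lie algebra, with the bracket induced by the bracket of vector fields, and let $\mathcal G=Gr(H)_x$ be the simply connected nilpotent Lie group with Lie algebra $\mathfrak n$, with a (left and right invariant) Haar measure and full group $C^*$-algebra $C^*(\mathcal G)$, the completion of $C_c(\mathcal G)$ with $(f*g)(t)=\int_{\mathcal G} f(y)g(y^{-1}t)\,dy$ and $f^*(t)=\overline{f(t^{-1})}$. Let $P\in\mathcal U(\mathfrak n)\otimes\mathbb C$, regarded as a left-invariant differential operator on $C_c^\infty(\mathcal G)$, where $X\in\mathfrak n$ acts by $(Xf)(t)=\frac{d}{ds}\big|_{s=0}f(t\exp sX)$. Let $P^*$ be the image of $P$ under the conjugate-linear extension of the principal anti-automorphism of $\mathcal U(\mathfrak n)$, which sends each $X\in\mathfrak n$ to $-X$.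 Then $P^*$ is also the adjoint of $P$ in each of the following senses. 1. (Hilbert module.) (i) In the left Hilbert module $C^*(\mathcal G)$ with $\langle a,b\rangle=b\,a^*$ (on which left-invariant operators are module maps): for $g\in C_c^\infty(\mathcal G)$ and $\zeta\in C^*(\mathcal G)$, one has $\langle Pf,g\rangle=\langle f,\zeta\rangle$ for all $f\in C_c^\infty(\mathcal G)$ if and only if $\zeta=P^*g$. (ii) In the right Hilbert module $C^*(\mathcal G)$ with $\langle a,b\rangle=a^*b$, where $P$ acts by the right-invariant operator $\lambda(P)f=(P\check f)^{\vee}$, $\check f(t)=f(t^{-1})$: for $g\in C_c^\infty(\mathcal G)$ and $\zeta\in C^*(\mathcal G)$, one has $\langle\lambda(P)f,g\rangle=\langle f,\zeta\rangle$ for all $f\in C_c^\infty(\mathcal G)$ if and only if $\zeta=\lambda(P^*)g$. 2. (Distributions.) Let $(u,f)=(Pf)(e)$, let $(u^*,f)=\overline{(u,f^*)}$, and for a distribution $w$ let $(Op(w)f)(y)=(w,f\circ l_y)$ with $l_y(z)=yz$. Then $Op(u)=P$ and $Op(u^*)=P^*$ on $C_c^\infty(\mathcal G)$, and $u^*$ is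 the distribution associated in the same way with $P^*$. Further, for every finite family $X_k\in\mathfrak n$, $e_k\in T_xM$, the element $S=-i\sum_k X_k(\mathrm{ext}(e_k)+\mathrm{int}(e_k))$ of $\mathcal U(\mathfrak n)\otimes\mathbb C\otimes\mathrm{End}(\Lambda^* T_xM)$ is formally self-adjoint in all these senses: (i) its matrix coefficients $S_{ab}=\langle a,Sb\rangle$, $a,b\in\Lambda^*T_xM$, satisfy $(S_{ab})^*=S_{ba}$; (ii) the distributions $u_{ab}$ associated with $S_{ab}$ satisfy $u_{ab}^*=u_{ba}$; (iii) $\langle SF,F'\rangle=\langle F,SF'\rangle$ for all $F,F'\in C_c^\infty(\mathcal G)\otimes\Lambda^*T_xM$, for the left Hilbert module inner product of $C^*(\mathcal G)\otimes\Lambda^*T_xM$, for the right one (with $X_k$ acting through $\lambda$), and for the $L^2$ inner product. In particular this holds for the cosymbol $\sigma_H(\mathcal D_G,x)$ of the orbital Dirac operator of a smooth action of a Lie group $G$ with Lie algebra $\mathfrak g$ on $M$. Here $f'_x:\mathfrak g\to T_xM$ is the derivative of the orbit map at the identity, $(v_k)$ is a basis of $\mathfrak g$ that is orthonormal for the given inner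 product on $\mathfrak g$ at $x$, all $f'_x(v_k)$ lie in $H^m_x$, $X_k$ is the class of $f'_x(v_k)$ in $H^m_x/H^{m-1}_x$, and $e_k=(f'_xf_x'^{*})^{-1/2}f'_x(v_k)$, with the inverse taken on the range of $f'_x$. -/

import Mathlib

open scoped Manifold ContDiff ENNReal TensorProduct Bundle
open Bundle
open MeasureTheory VectorField

set_option linter.unusedSectionVars false
set_option linter.unusedVariables false

noncomputable section

instance leInfty_minSmoothness (n : ℕ) : ENat.LEInfty (minSmoothness ℝ n) :=
  ⟨by rw [minSmoothness_of_isRCLikeNormedField]; exact ENat.LEInfty.out⟩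

instance leInfty_minSmoothness_ofNat (n : ℕ) [n.AtLeastTwo] :
    ENat.LEInfty (minSmoothness ℝ (no_index (OfNat.ofNat n))) :=
  leInfty_minSmoothness n

section Group

variable {E : Type*} [NormedAddCommGroup E] [NormedSpace ℝ E] [FiniteDimensional ℝ E]
  {G : Type*} [TopologicalSpace G] [ChartedSpace E G] [Group G] [LieGroup 𝓘(ℝ, E) ∞ G]

variable (E G) in
/-- The space `C_c^∞(G)` of smooth complex functions with compact support. -/
def TestFun : Submodule ℂ (G → ℂ) where
  carrier := {f | ContMDiff 𝓘(ℝ, E) 𝓘(ℝ, ℂ) ∞ f ∧ HasCompactSupport f}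
  zero_mem' := ⟨contMDiff_const, HasCompactSupport.zero⟩
  add_mem' hf hg := ⟨hf.1.add hg.1, hf.2.add hg.2⟩
  smul_mem' c f hf := ⟨by
    have : ContMDiff 𝓘(ℝ, E) 𝓘(ℝ, ℂ) ∞ (fun x => c * f x) :=
      ((contDiff_const (c := c)).mul contDiff_id).comp_contMDiff hf.1
    exact this, hf.2.smul_left (f := fun _ => c)⟩

/-- The derivative of `f` along the left-invariant vector field which extends `X`, that is
`t ↦ d/ds f (t exp (s X))` at `s = 0`. -/
def lieDeriv {F : Type*} [NormedAddCommGroup F] [NormedSpace ℝ F]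
    (X : GroupLieAlgebra 𝓘(ℝ, E) G) (f : G → F) (g : G) : F :=
  mvfderiv 𝓘(ℝ, E) f g (mulInvariantVectorField X g)

theorem contMDiff_lieDeriv {F : Type*} [NormedAddCommGroup F] [NormedSpace ℝ F]
    (X : GroupLieAlgebra 𝓘(ℝ, E) G) {f : G → F}
    (hf : ContMDiff 𝓘(ℝ, E) 𝓘(ℝ, F) ∞ f) : ContMDiff 𝓘(ℝ, E) 𝓘(ℝ, F) ∞ (lieDeriv X f) := by
  let I := 𝓘(ℝ, E)
  let fg : G → TangentBundle I G := fun g ↦ Bundle.TotalSpace.mk' E g 0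
  have sfg : CMDiff ∞ fg := Bundle.contMDiff_zeroSection ℝ _
  let fv : G → TangentBundle I G := fun _ ↦ Bundle.TotalSpace.mk' E 1 X
  have sfv : CMDiff ∞ fv := contMDiff_const
  let F₁ : G → (TangentBundle I G × TangentBundle I G) := fun g ↦ (fg g, fv g)
  have S₁ : CMDiff ∞ F₁ := sfg.prodMk sfv
  let F₂ : (TangentBundle I G × TangentBundle I G) → TangentBundle (I.prod I) (G × G) :=
    (equivTangentBundleProd I G I G).symm
  have S₂ : CMDiff ∞ F₂ := contMDiff_equivTangentBundleProd_symm
  have hm : ContMDiff (I.prod I) 𝓘(ℝ, F) ∞ (fun p : G × G ↦ f (p.1 * p.2)) :=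
    hf.comp (contMDiff_mul I ∞)
  have h1 : ContMDiff (I.prod I).tangent 𝓘(ℝ, F).tangent ∞
      (tangentMap (I.prod I) 𝓘(ℝ, F) (fun p : G × G ↦ f (p.1 * p.2))) :=
    hm.contMDiff_tangentMap le_rfl
  have S := (contMDiff_snd_tangentBundle_modelSpace F 𝓘(ℝ, F)).comp ((h1.comp S₂).comp S₁)
  refine S.congr (fun g => ?_)
  let X' : E := mfderiv 𝓘(ℝ, E) 𝓘(ℝ, E) (fun h : G => g * h) 1 X
  have h2 : lieDeriv X f g = mvfderiv 𝓘(ℝ, E) (fun h => f (g * h)) 1 X := by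
    have hd : MDifferentiableAt 𝓘(ℝ, E) 𝓘(ℝ, F) f (g * 1) := hf.mdifferentiableAt (by simp)
    have hg : MDifferentiableAt 𝓘(ℝ, E) 𝓘(ℝ, E) (fun h : G => g * h) 1 :=
      (contMDiff_mul_left (I := 𝓘(ℝ, E)) (n := ∞)).mdifferentiableAt (by simp)
    have := mfderiv_comp (I' := 𝓘(ℝ, E)) (1 : G) hd hg
    have h3 := DFunLike.congr_fun this X
    have h4 : g * 1 = g := mul_one g
    change _ = mfderiv 𝓘(ℝ, E) 𝓘(ℝ, F) (f ∘ fun h => g * h) 1 X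
    rw [h3]
    have h5 : ∀ a : G, a = g → mfderiv 𝓘(ℝ, E) 𝓘(ℝ, F) f g (X' : E) =
        (mfderiv 𝓘(ℝ, E) 𝓘(ℝ, F) f a (X' : E) : F) := by
      rintro _ rfl; rfl
    exact h5 (g * 1) h4
  rw [h2]
  change _ = mfderiv (I.prod I) 𝓘(ℝ, F) (fun p : G × G ↦ f (p.1 * p.2)) (g, 1) ((0 : E), (X : E))
  have hp := (hm.mdifferentiableAt (x := ((g, 1) : G × G)) (by simp)).hasMFDerivAt
  have hq : HasMFDerivAt I (I.prod I) (fun h : G => (g, h)) 1 _ :=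
    ((contMDiff_const (c := g)).prodMk contMDiff_id).mdifferentiableAt
      (I := I) (n := ∞) (by simp) |>.hasMFDerivAt
  have hc := HasMFDerivAt.comp (1 : G) hp hq
  have h5 := DFunLike.congr_fun hc.mfderiv X
  refine h5.trans ?_
  have h6 := DFunLike.congr_fun (mfderiv_prod_right (I := I) (I' := I) (x₀ := g) (y₀ := (1 : G))) X
  change mfderiv (I.prod I) 𝓘(ℝ, F) (fun p : G × G ↦ f (p.1 * p.2)) (g, 1)
    (mfderiv I (I.prod I) (fun h : G => (g, h)) 1 X) = _
  rw [h6]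
  rfl

theorem hasCompactSupport_lieDeriv (X : GroupLieAlgebra 𝓘(ℝ, E) G) {f : G → ℂ}
    (hf : HasCompactSupport f) : HasCompactSupport (lieDeriv X f) := by
  refine hf.of_isClosed_subset (isClosed_tsupport _) ?_
  refine closure_minimal (fun g hg => ?_) (isClosed_tsupport _)
  by_contra h
  have h0 : f =ᶠ[nhds g] fun _ => (0 : ℂ) := notMem_tsupport_iff_eventuallyEq.1 h
  apply hg
  have : mvfderiv 𝓘(ℝ, E) f g = 0 := by
    unfold mvfderiv
    rw [h0.mfderiv_eq]
    ext; simp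
    rfl
  simp [lieDeriv, this]

theorem lieDeriv_bracket_real (X Y : GroupLieAlgebra 𝓘(ℝ, E) G) {f : G → ℝ}
    (hf : ContMDiff 𝓘(ℝ, E) 𝓘(ℝ, ℝ) ∞ f) (g : G) :
    lieDeriv ⁅X, Y⁆ f g = lieDeriv X (lieDeriv Y f) g - lieDeriv Y (lieDeriv X f) g := by
  have hne : (∞ : ℕ∞ω) ≠ 0 := by simp
  by_cases hX : X = 0
  · subst hX
    have h0 : ∀ h : G → ℝ, lieDeriv (0 : GroupLieAlgebra 𝓘(ℝ, E) G) h = 0 := by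
      intro h; ext a
      have : mulInvariantVectorField (0 : GroupLieAlgebra 𝓘(ℝ, E) G) a = 0 := map_zero _
      rw [lieDeriv, this]; exact map_zero _
    have h1 : lieDeriv Y (0 : G → ℝ) g = 0 := by
      have := mvfderiv_const (I := 𝓘(ℝ, E)) (0 : ℝ) (x := g)
      change mvfderiv 𝓘(ℝ, E) (fun _ => (0:ℝ)) g _ = 0
      rw [this]; rfl
    simp only [zero_lie, h0, h1]; simp
  set V : ∀ h : G, TangentSpace 𝓘(ℝ, E) h := mulInvariantVectorField X with hV
  set W : ∀ h : G, TangentSpace 𝓘(ℝ, E) h := mulInvariantVectorField Y with hW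
  have hVne : V g ≠ 0 := by
    intro h0
    have h1 := mfderiv_comp (I := 𝓘(ℝ, E)) (I' := 𝓘(ℝ, E)) (I'' := 𝓘(ℝ, E)) (1 : G)
      (g := fun h => g⁻¹ * h) (f := fun h => g * h)
      ((contMDiff_mul_left (I := 𝓘(ℝ, E)) (n := ∞)).mdifferentiableAt hne)
      ((contMDiff_mul_left (I := 𝓘(ℝ, E)) (n := ∞)).mdifferentiableAt hne)
    have h2 : ((fun h => g⁻¹ * h) ∘ fun h => g * h) = (id : G → G) := by ext; simp
    rw [h2, mfderiv_id] at h1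
    apply hX
    have h3 := DFunLike.congr_fun h1 X
    refine h3.trans ?_
    change mfderiv 𝓘(ℝ, E) 𝓘(ℝ, E) (fun h : G => g⁻¹ * h) (g * 1) (V g) = 0
    rw [h0]
    exact map_zero _
  have dV : ∀ h, MDiffAt (T% V) h := fun h => mdifferentiableAt_mulInvariantVectorField X
  have dW : ∀ h, MDiffAt (T% W) h := fun h => mdifferentiableAt_mulInvariantVectorField Y
  have cV : ∀ h, CMDiffAt (minSmoothness ℝ 2) (T% V) h :=
    fun h => contMDiffAt_mulInvariantVectorField X
  have cW : ∀ h, CMDiffAt (minSmoothness ℝ 2) (T% W) h :=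
    fun h => contMDiffAt_mulInvariantVectorField Y
  have df : ∀ h, MDiffAt f h := fun h => hf.mdifferentiableAt hne
  have dXf : ∀ h, MDiffAt (lieDeriv X f) h := fun h => (contMDiff_lieDeriv X hf).mdifferentiableAt hne
  have dYf : ∀ h, MDiffAt (lieDeriv Y f) h := fun h => (contMDiff_lieDeriv Y hf).mdifferentiableAt hne
  have br : ∀ A B : GroupLieAlgebra 𝓘(ℝ, E) G, mlieBracket 𝓘(ℝ, E)
      (mulInvariantVectorField A) (mulInvariantVectorField B) = mulInvariantVectorField ⁅A, B⁆ :=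
    fun A B => (mulInvariantVector_mlieBracket A B).symm
  have cfV : ∀ h, CMDiffAt (minSmoothness ℝ 2) (T% (f • V)) h := by
    intro h
    have : CMDiffAt (minSmoothness ℝ 2) f h := hf.contMDiffAt.of_le ENat.LEInfty.out
    exact this.smul_section (cV h)
  have key := leibniz_identity_mlieBracket_apply (cV g) (cW g) (cfV g)
  have e1 : ∀ A : GroupLieAlgebra 𝓘(ℝ, E) G, mlieBracket 𝓘(ℝ, E) (mulInvariantVectorField A) (f • V)
      = lieDeriv A f • V + f • mulInvariantVectorField ⁅A, X⁆ := by
    intro A; ext h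
    rw [mlieBracket_smul_right (df h) (dV h), br]
    rfl
  have e2 : ∀ (A B : GroupLieAlgebra 𝓘(ℝ, E) G) (k : G → ℝ), MDiffAt k g →
      mlieBracket 𝓘(ℝ, E) (mulInvariantVectorField A) (k • mulInvariantVectorField B) g
      = lieDeriv A k g • mulInvariantVectorField B g + k g • mulInvariantVectorField ⁅A, B⁆ g := by
    intro A B k hk
    rw [mlieBracket_smul_right hk (mdifferentiableAt_mulInvariantVectorField B), br]
    rfl
  have dB : ∀ B, MDiffAt (T% (mulInvariantVectorField (B : GroupLieAlgebra 𝓘(ℝ, E) G))) g :=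
    fun B => mdifferentiableAt_mulInvariantVectorField B
  have ds : ∀ (k : G → ℝ) (B : GroupLieAlgebra 𝓘(ℝ, E) G), MDiffAt k g →
      MDiffAt (T% (k • mulInvariantVectorField B)) g := fun k B hk => hk.smul_section (dB B)
  have p : ∀ A B : GroupLieAlgebra 𝓘(ℝ, E) G, mlieBracket 𝓘(ℝ, E) (mulInvariantVectorField A)
      (lieDeriv B f • V + f • mulInvariantVectorField ⁅B, X⁆) g =
      (lieDeriv A (lieDeriv B f) g • V g + lieDeriv B f g • mulInvariantVectorField ⁅A, X⁆ g) +
      (lieDeriv A f g • mulInvariantVectorField ⁅B, X⁆ g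
        + f g • mulInvariantVectorField ⁅A, ⁅B, X⁆⁆ g) := by
    intro A B
    have hk : MDiffAt (lieDeriv B f) g := (contMDiff_lieDeriv B hf).mdifferentiableAt hne
    rw [mlieBracket_add_right (ds _ _ hk) (ds _ _ (df g)), e2 _ _ _ hk, e2 _ _ _ (df g)]
  rw [br, e1, e1, e1, p, p] at key
  have z : mulInvariantVectorField (0 : GroupLieAlgebra 𝓘(ℝ, E) G) g = 0 := map_zero _
  have j : ⁅⁅X, Y⁆, X⁆ = ⁅X, ⁅Y, X⁆⁆ := by
    rw [← lie_skew, ← lie_neg, lie_skew]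
  have key' : (lieDeriv X (lieDeriv Y f) g • V g + lieDeriv Y f g • mulInvariantVectorField ⁅X, X⁆ g) +
      (lieDeriv X f g • mulInvariantVectorField ⁅Y, X⁆ g
        + f g • mulInvariantVectorField ⁅X, ⁅Y, X⁆⁆ g) =
      (lieDeriv ⁅X, Y⁆ f g • V g + f g • mulInvariantVectorField ⁅⁅X, Y⁆, X⁆ g) +
      ((lieDeriv Y (lieDeriv X f) g • V g + lieDeriv X f g • mulInvariantVectorField ⁅Y, X⁆ g) +
      (lieDeriv Y f g • mulInvariantVectorField ⁅X, X⁆ g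
        + f g • mulInvariantVectorField ⁅Y, ⁅X, X⁆⁆ g)) := key
  rw [j, lie_self, lie_zero, z] at key'
  generalize mulInvariantVectorField ⁅Y, X⁆ g = a at key'
  generalize mulInvariantVectorField ⁅X, ⁅Y, X⁆⁆ g = b at key'
  have k2 : (lieDeriv ⁅X, Y⁆ f g - (lieDeriv X (lieDeriv Y f) g - lieDeriv Y (lieDeriv X f) g)) •
      V g = 0 := by
    rw [sub_smul, sub_smul]
    simp only [smul_zero, add_zero] at key'
    rw [sub_eq_zero, eq_comm, sub_eq_iff_eq_add]
    have := congrArg (fun t => t - (lieDeriv X f g • a + f g • b)) key'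
    simp only [add_sub_cancel_right] at this
    rw [this]; abel
  exact sub_eq_zero.1 ((smul_eq_zero.1 k2).resolve_right hVne)

theorem lieDeriv_clm {F F' : Type*} [NormedAddCommGroup F] [NormedSpace ℝ F]
    [NormedAddCommGroup F'] [NormedSpace ℝ F'] (L : F →L[ℝ] F')
    (X : GroupLieAlgebra 𝓘(ℝ, E) G) {f : G → F}
    (hf : ContMDiff 𝓘(ℝ, E) 𝓘(ℝ, F) ∞ f) (g : G) :
    lieDeriv X (fun h => L (f h)) g = L (lieDeriv X f g) := by
  have h := (L.hasMFDerivAt (x := f g)).comp g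
    (hf.mdifferentiableAt (x := g) (by simp)).hasMFDerivAt
  exact DFunLike.congr_fun h.mfderiv (mulInvariantVectorField X g)

theorem lieDeriv_bracket (X Y : GroupLieAlgebra 𝓘(ℝ, E) G) {f : G → ℂ}
    (hf : ContMDiff 𝓘(ℝ, E) 𝓘(ℝ, ℂ) ∞ f) (g : G) :
    lieDeriv ⁅X, Y⁆ f g = lieDeriv X (lieDeriv Y f) g - lieDeriv Y (lieDeriv X f) g := by
  have main : ∀ L : ℂ →L[ℝ] ℝ, L (lieDeriv ⁅X, Y⁆ f g) =
      L (lieDeriv X (lieDeriv Y f) g - lieDeriv Y (lieDeriv X f) g) := by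
    intro L
    have hL : ContMDiff 𝓘(ℝ, E) 𝓘(ℝ, ℝ) ∞ (fun h => L (f h)) := L.contMDiff.comp hf
    have hc : ∀ Z, lieDeriv Z (fun h => L (f h)) = fun h => L (lieDeriv Z f h) :=
      fun Z => funext fun h => lieDeriv_clm L Z hf h
    have := lieDeriv_bracket_real X Y hL g
    rwa [hc, hc, hc, lieDeriv_clm L X (contMDiff_lieDeriv Y hf),
      lieDeriv_clm L Y (contMDiff_lieDeriv X hf), ← map_sub] at this
  exact Complex.ext (main Complex.reCLM) (main Complex.imCLM)

theorem lieDeriv_add_left {f : G → ℂ} (X Y : GroupLieAlgebra 𝓘(ℝ, E) G) :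
    lieDeriv (X + Y) f = lieDeriv X f + lieDeriv Y f := by
  ext g
  have : mulInvariantVectorField (X + Y) g
      = mulInvariantVectorField X g + mulInvariantVectorField Y g := map_add _ X Y
  exact (congrArg _ this).trans (map_add _ _ _)

theorem lieDeriv_smul_left {f : G → ℂ} (c : ℝ) (X : GroupLieAlgebra 𝓘(ℝ, E) G) :
    lieDeriv (c • X) f = fun g => (c : ℂ) * lieDeriv X f g := by
  ext g
  have : mulInvariantVectorField (c • X) g = c • mulInvariantVectorField X g := map_smul _ c X
  exact ((congrArg _ this).trans (map_smul _ _ _)).trans (Complex.real_smul)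

theorem lieDeriv_add {f k : G → ℂ} (X : GroupLieAlgebra 𝓘(ℝ, E) G)
    (hf : ContMDiff 𝓘(ℝ, E) 𝓘(ℝ, ℂ) ∞ f) (hk : ContMDiff 𝓘(ℝ, E) 𝓘(ℝ, ℂ) ∞ k) :
    lieDeriv X (f + k) = lieDeriv X f + lieDeriv X k := by
  ext g
  have := mvfderiv_add (hf.mdifferentiableAt (x := g) (by simp))
    (hk.mdifferentiableAt (x := g) (by simp))
  exact DFunLike.congr_fun this (mulInvariantVectorField X g)

theorem lieDeriv_const_mul {f : G → ℂ} (c : ℂ) (X : GroupLieAlgebra 𝓘(ℝ, E) G)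
    (hf : ContMDiff 𝓘(ℝ, E) 𝓘(ℝ, ℂ) ∞ f) :
    lieDeriv X (fun g => c * f g) = fun g => c * lieDeriv X f g :=
  funext fun g => lieDeriv_clm (ContinuousLinearMap.mul ℝ ℂ c) X hf g

namespace TestFun

theorem contMDiff (f : TestFun E G) : ContMDiff 𝓘(ℝ, E) 𝓘(ℝ, ℂ) ∞ (f : G → ℂ) := f.2.1

/-- The left-invariant vector field `X` as an operator on test functions. -/
def deriv (X : GroupLieAlgebra 𝓘(ℝ, E) G) : TestFun E G →ₗ[ℂ] TestFun E G where
  toFun f := ⟨lieDeriv X (f : G → ℂ), contMDiff_lieDeriv X f.2.1, hasCompactSupport_lieDeriv X f.2.2⟩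
  map_add' f k := Subtype.ext (lieDeriv_add X f.2.1 k.2.1)
  map_smul' c f := Subtype.ext (lieDeriv_const_mul c X f.2.1)

attribute [local instance 100] LieRing.ofAssociativeRing

/-- The Lie algebra of `G` acts on test functions. -/
def derivLie : GroupLieAlgebra 𝓘(ℝ, E) G →ₗ⁅ℝ⁆ Module.End ℂ (TestFun E G) where
  toFun := deriv
  map_add' X Y := LinearMap.ext fun f => Subtype.ext (lieDeriv_add_left X Y)
  map_smul' c X := LinearMap.ext fun f => Subtype.ext (lieDeriv_smul_left c X)
  map_lie' {X Y} := LinearMap.ext fun f => Subtype.ext (funext fun g => lieDeriv_bracket X Y f.2.1 g)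

end TestFun

end Group

section Enveloping

attribute [local instance 100] LieRing.ofAssociativeRing

variable {L : Type*} [LieRing L] [LieAlgebra ℝ L]

variable (L) in
/-- The complexified universal enveloping algebra `ℂ ⊗ U(L)` of a real Lie algebra `L`. -/
abbrev ComplexEnveloping : Type _ := ℂ ⊗[ℝ] UniversalEnvelopingAlgebra ℝ L

variable (L) in
/-- The principal anti-automorphism of `U(L)`: the algebra homomorphism from `U(L)` to its opposite
algebra which extends `X ↦ -X`. -/
def principalAnti :
    UniversalEnvelopingAlgebra ℝ L →ₐ[ℝ] (UniversalEnvelopingAlgebra ℝ L)ᵐᵒᵖ :=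
  UniversalEnvelopingAlgebra.lift ℝ
    { toFun := fun X => MulOpposite.op (-(UniversalEnvelopingAlgebra.ι ℝ X))
      map_add' := fun X Y => by simp [add_comm]
      map_smul' := fun c X => by simp
      map_lie' := fun {X Y} => by
        simp only [LieHom.map_lie, LieRing.of_associative_ring_bracket, ← MulOpposite.op_mul,
          ← MulOpposite.op_sub]
        congr 1; noncomm_ring }

variable (L) in
/-- The adjoint in the complexified enveloping algebra: the conjugate-linear extension of the principal
anti-automorphism. -/
def envAdjoint : ComplexEnveloping L →ₗ[ℝ] ComplexEnveloping L :=
  TensorProduct.map Complex.conjAe.toLinearMap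
    ((MulOpposite.opLinearEquiv ℝ).symm.toLinearMap ∘ₗ (principalAnti L).toLinearMap)

end Enveloping

section Operators

attribute [local instance 100] LieRing.ofAssociativeRing

variable {E : Type*} [NormedAddCommGroup E] [NormedSpace ℝ E] [FiniteDimensional ℝ E]
  {G : Type*} [TopologicalSpace G] [ChartedSpace E G] [Group G] [LieGroup 𝓘(ℝ, E) ∞ G]
  {L : Type*} [LieRing L] [LieAlgebra ℝ L]

/-- The action of the enveloping algebra on test functions by left-invariant differential operators, where
`φ` identifies `L` with the Lie algebra of `G`; an element of `L` acts through `lieDeriv`. -/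
def leftInvOp (φ : L →ₗ⁅ℝ⁆ GroupLieAlgebra 𝓘(ℝ, E) G) :
    ComplexEnveloping L →ₐ[ℂ] Module.End ℂ (TestFun E G) :=
  Algebra.TensorProduct.lift (Algebra.ofId ℂ _)
    (UniversalEnvelopingAlgebra.lift ℝ (TestFun.derivLie.comp φ))
    (fun c _ => Algebra.commute_algebraMap_left c _)

namespace TestFun

/-- The involution `f^*(t) = conj (f (t⁻¹))`. -/
def invol (f : TestFun E G) : TestFun E G :=
  ⟨fun t => starRingEnd ℂ (f.1 t⁻¹), by
    have h1 : ContMDiff 𝓘(ℝ, E) 𝓘(ℝ, ℂ) ∞ (fun t => f.1 t⁻¹) :=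
      f.2.1.comp (contMDiff_inv 𝓘(ℝ, E) ∞)
    exact ⟨Complex.conjCLE.contDiff.comp_contMDiff h1, by
      have := topologicalGroup_of_lieGroup 𝓘(ℝ, E) ∞ (G := G)
      exact (f.2.2.comp_homeomorph (Homeomorph.inv G)).comp_left (g := starRingEnd ℂ) (map_zero _)⟩⟩

/-- The map `f ↦ f ∘ inv`. -/
def reflect : TestFun E G →ₗ[ℂ] TestFun E G where
  toFun f := ⟨fun t => f.1 t⁻¹, f.2.1.comp (contMDiff_inv 𝓘(ℝ, E) ∞), by
      have := topologicalGroup_of_lieGroup 𝓘(ℝ, E) ∞ (G := G)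
      exact f.2.2.comp_homeomorph (Homeomorph.inv G)⟩
  map_add' _ _ := rfl
  map_smul' _ _ := rfl

/-- The function `f ∘ l_x`, where `l_x y = x y`. -/
def translate (x : G) (f : TestFun E G) : TestFun E G :=
  ⟨fun y => f.1 (x * y), f.2.1.comp contMDiff_mul_left, by
      have := topologicalGroup_of_lieGroup 𝓘(ℝ, E) ∞ (G := G)
      exact f.2.2.comp_homeomorph (Homeomorph.mulLeft x)⟩

variable (E G) in
/-- Linear functionals on test functions. -/
abbrev Functional : Type _ := TestFun E G →ₗ[ℂ] ℂ

/-- The functional `(u, f) = (T f) (1)` associated with an operator `T`. -/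
def kernelAtOne (T : Module.End ℂ (TestFun E G)) : Functional E G where
  toFun f := (T f).1 1
  map_add' f k := by simp
  map_smul' c f := by simp

/-- The involution `(u^*, f) = conj (u, f^*)` on functionals. -/
def Functional.star (u : Functional E G) : Functional E G where
  toFun f := starRingEnd ℂ (u (invol f))
  map_add' f k := by
    have : invol (f + k) = invol f + invol k := by
      apply Subtype.ext; funext t; simp [invol]
    simp [this]
  map_smul' c f := by
    have : invol (c • f) = starRingEnd ℂ c • invol f := by
      apply Subtype.ext; funext t; simp [invol]
    simp [this]

/-- The operator `(Op(u) f) (x) = (u, f ∘ l_x)`, where `l_x y = x y`. -/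
def Functional.toOp (u : Functional E G) (f : TestFun E G) (x : G) : ℂ := u (translate x f)

end TestFun

end Operators

section GroupCStar

variable (G : Type*) [Group G] [TopologicalSpace G]

/-- A strongly continuous unitary representation on a Hilbert space. (For second countable groups all
representations are sums of representations on separable spaces, so that Hilbert spaces in `Type` suffice to
compute the norm of the full group algebra.) -/
structure UnitaryRep where
  /-- the underlying Hilbert space -/
  H : Type
  [normedAddCommGroup : NormedAddCommGroup H]
  [innerProductSpace : InnerProductSpace ℂ H]
  [completeSpace : CompleteSpace H]
  /-- the group action -/
  U : G →* unitary (H →L[ℂ] H)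
  continuous_apply : ∀ v : H, Continuous fun g => (U g : H →L[ℂ] H) v

namespace UnitaryRep

attribute [instance] normedAddCommGroup innerProductSpace completeSpace

variable {G}

theorem norm_apply (ρ : UnitaryRep G) (g : G) (v : ρ.H) : ‖(ρ.U g : ρ.H →L[ℂ] ρ.H) v‖ = ‖v‖ :=
  (ContinuousLinearMap.norm_map_of_mem_unitary (ρ.U g).2) v

variable [MeasurableSpace G] [BorelSpace G] (μ : Measure G) [IsFiniteMeasureOnCompacts μ]

theorem integrable (ρ : UnitaryRep G) (f : CompactlySupportedContinuousMap G ℂ) (v : ρ.H) :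
    Integrable (fun g => f g • (ρ.U g : ρ.H →L[ℂ] ρ.H) v) μ := by
  refine Continuous.integrable_of_hasCompactSupport (f.continuous.smul (ρ.continuous_apply v)) ?_
  exact f.hasCompactSupport.smul_right

theorem norm_integral_le (ρ : UnitaryRep G) (f : CompactlySupportedContinuousMap G ℂ) (v : ρ.H) :
    ‖∫ g, f g • (ρ.U g : ρ.H →L[ℂ] ρ.H) v ∂μ‖ ≤ (∫ g, ‖f g‖ ∂μ) * ‖v‖ := by
  refine (norm_integral_le_integral_norm _).trans (le_of_eq ?_)
  simp only [norm_smul, norm_apply]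
  exact integral_mul_const _ _

/-- The integrated form `v ↦ ∫ f(g) U(g) v dμ(g)` of a unitary representation. -/
def integrated (ρ : UnitaryRep G) (f : CompactlySupportedContinuousMap G ℂ) : ρ.H →L[ℂ] ρ.H :=
  LinearMap.mkContinuous
    { toFun := fun v => ∫ g, f g • (ρ.U g : ρ.H →L[ℂ] ρ.H) v ∂μ
      map_add' := fun v w => by
        simp only [map_add, smul_add]
        exact integral_add (ρ.integrable μ f v) (ρ.integrable μ f w)
      map_smul' := fun c v => by
        simp only [map_smul, RingHom.id_apply]
        rw [← integral_smul]
        simp only [smul_comm c] }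
    (∫ g, ‖f g‖ ∂μ) (ρ.norm_integral_le μ f)

theorem norm_integrated_le (ρ : UnitaryRep G) (f : CompactlySupportedContinuousMap G ℂ) :
    ‖ρ.integrated μ f‖ ≤ ∫ g, ‖f g‖ ∂μ :=
  LinearMap.mkContinuous_norm_le _ (integral_nonneg fun _ => norm_nonneg _) _

end UnitaryRep

/-- Bounded families of operators on the spaces of all unitary representations, a C*-algebra with the supremum
norm. -/
def UniversalAlgebra : Type _ := lp (fun ρ : UnitaryRep G => ρ.H →L[ℂ] ρ.H) ∞

instance : NonUnitalCStarAlgebra (UniversalAlgebra G) :=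
  inferInstanceAs (NonUnitalCStarAlgebra (lp (fun ρ : UnitaryRep G => ρ.H →L[ℂ] ρ.H) ∞))

variable {G}
variable [MeasurableSpace G] [BorelSpace G] (μ : Measure G) [IsFiniteMeasureOnCompacts μ]

/-- The family of the integrated forms of `f` in all unitary representations. -/
def universalRep (f : CompactlySupportedContinuousMap G ℂ) : UniversalAlgebra G :=
  ⟨fun ρ => ρ.integrated μ f, memℓp_infty ⟨∫ g, ‖f g‖ ∂μ, by
    rintro _ ⟨ρ, rfl⟩; exact ρ.norm_integrated_le μ f⟩⟩

/-- The closed *-subalgebra generated by the image of `C_c(G)`. -/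
def groupCStarSubalgebra : NonUnitalStarSubalgebra ℂ (UniversalAlgebra G) :=
  (NonUnitalStarAlgebra.adjoin ℂ (Set.range (universalRep μ))).topologicalClosure

instance : IsClosed (groupCStarSubalgebra μ : Set (UniversalAlgebra G)) :=
  NonUnitalStarSubalgebra.isClosed_topologicalClosure _

/-- The full group C*-algebra `C^*(G)`: the completion of `C_c(G)` for the supremum of the norms in all unitary
representations. -/
def GroupCStar : Type _ := groupCStarSubalgebra μ

instance : NonUnitalCStarAlgebra (GroupCStar μ) :=
  inferInstanceAs (NonUnitalCStarAlgebra (groupCStarSubalgebra μ))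

theorem universalRep_mem (f : CompactlySupportedContinuousMap G ℂ) :
    universalRep μ f ∈ groupCStarSubalgebra μ :=
  NonUnitalStarSubalgebra.le_topologicalClosure _
    (NonUnitalStarAlgebra.subset_adjoin ℂ _ ⟨f, rfl⟩)

theorem universalRep_add (f k : CompactlySupportedContinuousMap G ℂ) :
    universalRep μ (f + k) = universalRep μ f + universalRep μ k := by
  apply Subtype.ext
  funext ρ
  refine ContinuousLinearMap.ext fun v => ?_
  refine (integral_congr_ae (Filter.Eventually.of_forall fun g => ?_)).trans
    (integral_add (ρ.integrable μ f v) (ρ.integrable μ k v))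
  exact add_smul (f g) (k g) _

theorem universalRep_smul (c : ℂ) (f : CompactlySupportedContinuousMap G ℂ) :
    universalRep μ (c • f) = c • universalRep μ f := by
  apply Subtype.ext
  funext ρ
  refine ContinuousLinearMap.ext fun v => ?_
  refine (integral_congr_ae (Filter.Eventually.of_forall fun g => ?_)).trans
    (integral_smul c _)
  exact mul_smul c (f g) _

/-- The canonical map `C_c(G) → C*(G)`. -/
def GroupCStar.of : CompactlySupportedContinuousMap G ℂ →ₗ[ℂ] GroupCStar μ where
  toFun f := ⟨universalRep μ f, universalRep_mem μ f⟩
  map_add' f k := Subtype.ext (universalRep_add μ f k)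
  map_smul' c f := Subtype.ext (universalRep_smul μ c f)

end GroupCStar

section Exterior

variable {V : Type*} [NormedAddCommGroup V] [InnerProductSpace ℝ V]

/-- Exterior multiplication `ext e`. -/
def extMul (e : V) : Module.End ℝ (ExteriorAlgebra ℝ V) :=
  LinearMap.mulLeft ℝ (ExteriorAlgebra.ι ℝ e)

/-- Interior multiplication `int e`: the antiderivation with `int e v = ⟪e, v⟫` on vectors. -/
def intMul : V →ₗ[ℝ] Module.End ℝ (ExteriorAlgebra ℝ V) :=
  CliffordAlgebra.contractLeft ∘ₗ innerₗ V

variable (V) in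
/-- The extension of `intMul` to an algebra homomorphism on the exterior algebra. -/
def intMulHom : ExteriorAlgebra ℝ V →ₐ[ℝ] Module.End ℝ (ExteriorAlgebra ℝ V) :=
  ExteriorAlgebra.lift ℝ ⟨intMul, fun e => LinearMap.ext fun a =>
    CliffordAlgebra.contractLeft_contractLeft (innerₗ V e) a⟩

variable (V) in
/-- The inner product of the exterior algebra: `⟪v₁ ∧ ⋯ ∧ v_p, b⟫` is the scalar part of
`int v_p ⋯ int v₁ b`. -/
def extForm : ExteriorAlgebra ℝ V →ₗ[ℝ] ExteriorAlgebra ℝ V →ₗ[ℝ] ℝ :=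
  LinearMap.mk₂ ℝ (fun a b => ExteriorAlgebra.algebraMapInv
      (intMulHom V (CliffordAlgebra.reverse a) b))
    (by intros; simp) (by intros; simp) (by intros; simp) (by intros; simp)

/-- The form `⟨f ⊗ a, k ⊗ b⟩ = ⟪a, b⟫ ⟨f, k⟩` on a tensor product with the exterior algebra. -/
def tensorForm {D A : Type*} [AddCommGroup D] [Module ℝ D] [AddCommGroup A] [Module ℝ A]
    (S : D →ₗ[ℝ] D →ₗ[ℝ] A) :
    (D ⊗[ℝ] ExteriorAlgebra ℝ V) →ₗ[ℝ] (D ⊗[ℝ] ExteriorAlgebra ℝ V) →ₗ[ℝ] A :=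
  (TensorProduct.map₂ S (extForm V)).compr₂ (TensorProduct.rid ℝ A).toLinearMap

/-- The matrix coefficient `⟪a, S b⟫ ∈ R` of an element `S` of `R ⊗ End (Λ V)`. -/
def matrixCoeff {R : Type*} [AddCommGroup R] [Module ℝ R] (a b : ExteriorAlgebra ℝ V) :
    R ⊗[ℝ] Module.End ℝ (ExteriorAlgebra ℝ V) →ₗ[ℝ] R :=
  (TensorProduct.rid ℝ R).toLinearMap ∘ₗ
    TensorProduct.map LinearMap.id (extForm V a ∘ₗ LinearMap.applyₗ b)

end Exterior

section Forms

variable {E : Type*} [NormedAddCommGroup E] [NormedSpace ℝ E] [FiniteDimensional ℝ E]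
  {G : Type*} [TopologicalSpace G] [ChartedSpace E G] [Group G] [LieGroup 𝓘(ℝ, E) ∞ G]
  {L : Type*} [LieRing L] [LieAlgebra ℝ L]
  {V : Type*} [NormedAddCommGroup V] [InnerProductSpace ℝ V]

/-- `leftInvOp`, with scalars restricted to `ℝ`. -/
def leftInvOpReal (φ : L →ₗ⁅ℝ⁆ GroupLieAlgebra 𝓘(ℝ, E) G) :
    ComplexEnveloping L →ₗ[ℝ] (TestFun E G →ₗ[ℝ] TestFun E G) where
  toFun P :=
    { toFun := fun f => leftInvOp φ P f
      map_add' := fun f k => map_add _ f k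
      map_smul' := fun c f => (leftInvOp φ P).map_smul (c : ℂ) f }
  map_add' P Q := by ext1 f; exact congrArg (fun T => T f) (map_add (leftInvOp φ) P Q)
  map_smul' c P := by
    have h : c • P = (c : ℂ) • P := (algebraMap_smul ℂ c P).symm
    ext1 f
    exact congrArg (fun T => T f) ((congrArg (leftInvOp φ) h).trans (map_smul (leftInvOp φ) (c : ℂ) P))

/-- The action of `U(L) ⊗ End (Λ V)` on `C_c^∞(G) ⊗ Λ V`, by left-invariant differential operators on the
first factor. -/
def matrixOp (φ : L →ₗ⁅ℝ⁆ GroupLieAlgebra 𝓘(ℝ, E) G) :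
    ComplexEnveloping L ⊗[ℝ] Module.End ℝ (ExteriorAlgebra ℝ V) →ₗ[ℝ]
      Module.End ℝ (TestFun E G ⊗[ℝ] ExteriorAlgebra ℝ V) :=
  TensorProduct.homTensorHomMap (RingHom.id ℝ) _ _ _ _ ∘ₗ
    TensorProduct.map (leftInvOpReal φ) LinearMap.id

/-- The right-invariant operator `f ↦ (P (f ∘ inv)) ∘ inv`, where `P` is left-invariant. -/
def rightInvOp (φ : L →ₗ⁅ℝ⁆ GroupLieAlgebra 𝓘(ℝ, E) G) (P : ComplexEnveloping L) :
    Module.End ℂ (TestFun E G) :=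
  TestFun.reflect ∘ₗ leftInvOp φ P ∘ₗ TestFun.reflect

/-- The analogue of `matrixOp` for right-invariant operators. -/
def matrixOpRight (φ : L →ₗ⁅ℝ⁆ GroupLieAlgebra 𝓘(ℝ, E) G)
    (S : ComplexEnveloping L ⊗[ℝ] Module.End ℝ (ExteriorAlgebra ℝ V)) :
    Module.End ℝ (TestFun E G ⊗[ℝ] ExteriorAlgebra ℝ V) :=
  TensorProduct.map (TestFun.reflect.restrictScalars ℝ) LinearMap.id ∘ₗ matrixOp φ S ∘ₗ
    TensorProduct.map (TestFun.reflect.restrictScalars ℝ) LinearMap.id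

variable [MeasurableSpace G] [BorelSpace G] (μ : Measure G) [IsFiniteMeasureOnCompacts μ]

namespace TestFun

/-- A test function as a continuous function with compact support. -/
def toCc : TestFun E G →ₗ[ℂ] CompactlySupportedContinuousMap G ℂ where
  toFun f := ⟨⟨f.1, f.2.1.continuous⟩, f.2.2⟩
  map_add' _ _ := rfl
  map_smul' _ _ := rfl

/-- The canonical map from test functions to `C^*(G)`. -/
def toCStar : TestFun E G →ₗ[ℂ] GroupCStar μ := GroupCStar.of μ ∘ₗ toCc

end TestFun

open TestFun

variable {μ} in
/-- The inner product `⟨a, b⟩ = b a^*` of `C^*(G)` as a left Hilbert module over itself, conjugate linear in the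
first variable. -/
def leftInner (a b : GroupCStar μ) : GroupCStar μ := b * star a

variable {μ} in
/-- The inner product `⟨a, b⟩ = a^* b` of `C^*(G)` as a right Hilbert module over itself. -/
def rightInner (a b : GroupCStar μ) : GroupCStar μ := star a * b

/-- The `C^*(G)`-valued inner product of the left Hilbert module, on test functions. -/
def cstarForm : TestFun E G →ₗ[ℝ] TestFun E G →ₗ[ℝ] GroupCStar μ :=
  LinearMap.mk₂ ℝ (fun f k => leftInner (toCStar μ f) (toCStar μ k))
    (fun f f' k => by simp [leftInner, mul_add])
    (fun c f k => by
      have : toCStar μ (c • f) = c • toCStar μ f := (toCStar μ).map_smul (c : ℂ) f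
      simp [leftInner, this, mul_smul_comm])
    (fun f k k' => by simp [leftInner, add_mul])
    (fun c f k => by
      have : toCStar μ (c • k) = c • toCStar μ k := (toCStar μ).map_smul (c : ℂ) k
      simp [leftInner, this, smul_mul_assoc])

/-- The `C^*(G)`-valued inner product of the right Hilbert module, on test functions. -/
def cstarFormRight : TestFun E G →ₗ[ℝ] TestFun E G →ₗ[ℝ] GroupCStar μ :=
  LinearMap.mk₂ ℝ (fun f k => rightInner (toCStar μ f) (toCStar μ k))
    (fun f f' k => by simp [rightInner, add_mul])
    (fun c f k => by
      have : toCStar μ (c • f) = c • toCStar μ f := (toCStar μ).map_smul (c : ℂ) f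
      simp [rightInner, this, smul_mul_assoc])
    (fun f k k' => by simp [rightInner, mul_add])
    (fun c f k => by
      have : toCStar μ (c • k) = c • toCStar μ k := (toCStar μ).map_smul (c : ℂ) k
      simp [rightInner, this, mul_smul_comm])

theorem TestFun.integrable_conj_mul (f k : TestFun E G) :
    Integrable (fun g => starRingEnd ℂ (f.1 g) * k.1 g) μ :=
  Continuous.integrable_of_hasCompactSupport
    ((Complex.continuous_conj.comp f.2.1.continuous).mul k.2.1.continuous)
    (k.2.2.mul_left)

/-- The `L^2` inner product on test functions. -/
def l2Form : TestFun E G →ₗ[ℝ] TestFun E G →ₗ[ℝ] ℂ :=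
  LinearMap.mk₂ ℝ (fun f k => ∫ g, starRingEnd ℂ (f.1 g) * k.1 g ∂μ)
    (fun f f' k => by
      rw [← integral_add (TestFun.integrable_conj_mul μ f k) (TestFun.integrable_conj_mul μ f' k)]
      exact integral_congr_ae (Filter.Eventually.of_forall fun g => by simp [add_mul]))
    (fun c f k => by
      rw [← integral_smul]
      exact integral_congr_ae (Filter.Eventually.of_forall fun g => by simp [mul_assoc]))
    (fun f k k' => by
      rw [← integral_add (TestFun.integrable_conj_mul μ f k) (TestFun.integrable_conj_mul μ f k')]
      exact integral_congr_ae (Filter.Eventually.of_forall fun g => by simp [mul_add]))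
    (fun c f k => by
      rw [← integral_smul]
      exact integral_congr_ae (Filter.Eventually.of_forall fun g => by simp [mul_left_comm]))

end Forms

section GradedBracket

variable {T : Type*} [AddCommGroup T] [Module ℝ T]

/-- The `i`-th graded piece `H i / H (i - 1)` of a filtration. -/
abbrev GradedPiece (H : ℕ → Submodule ℝ T) (i : ℕ) : Type _ :=
  H i ⧸ (H (i - 1)).submoduleOf (H i)

/-- The associated graded vector space `⨁ i, H i / H (i - 1)` of a filtration. -/
abbrev AssocGraded (H : ℕ → Submodule ℝ T) : Type _ := DirectSum ℕ fun i => GradedPiece H i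

/-- The class in degree `i` of a vector `v ∈ H i`. -/
def gradedClass (H : ℕ → Submodule ℝ T) (i : ℕ) : H i →ₗ[ℝ] AssocGraded H :=
  DirectSum.lof ℝ ℕ (fun i => GradedPiece H i) i ∘ₗ ((H (i - 1)).submoduleOf (H i)).mkQ

/-- A bilinear map is compatible with a filtration. -/
structure IsFilteredBilin (H : ℕ → Submodule ℝ T) (B : T →ₗ[ℝ] T →ₗ[ℝ] T) : Prop where
  zero : H 0 = ⊥
  mono : Monotone H
  mem : ∀ {i j v w}, v ∈ H i → w ∈ H j → B v w ∈ H (i + j)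

namespace IsFilteredBilin

variable {H : ℕ → Submodule ℝ T} {B : T →ₗ[ℝ] T →ₗ[ℝ] T}

theorem mem_right (h : IsFilteredBilin H B) {i j : ℕ} {v w : T} (hv : v ∈ H i)
    (hw : w ∈ H (j - 1)) : B v w ∈ H (i + j - 1) := by
  rcases j with _ | j
  · have : w = 0 := by simpa [h.zero] using hw
    simp [this]
  · exact h.mem hv hw

theorem mem_left (h : IsFilteredBilin H B) {i j : ℕ} {v w : T} (hv : v ∈ H (i - 1))
    (hw : w ∈ H j) : B v w ∈ H (i + j - 1) := by
  rcases i with _ | i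
  · have : v = 0 := by simpa [h.zero] using hv
    simp [this]
  · have := h.mem hv hw
    simpa [Nat.succ_add] using this

theorem mk_congr {i : ℕ} {v w : H i} (hvw : v.1 = w.1) :
    ((H (i - 1)).submoduleOf (H i)).mkQ v = ((H (i - 1)).submoduleOf (H i)).mkQ w :=
  congrArg _ (Subtype.ext hvw)

/-- A vector `v ∈ H i` induces a map from degree `j` to degree `i + j`. -/
def pieceAux (h : IsFilteredBilin H B) (i j : ℕ) (v : H i) :
    GradedPiece H j →ₗ[ℝ] GradedPiece H (i + j) :=
  Submodule.mapQ _ _ ((B v.1).restrict (p := H j) (q := H (i + j)) fun w hw => h.mem v.2 hw)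
    (fun w hw => h.mem_right v.2 hw)

/-- The bilinear map induced on graded pieces. -/
def piece (h : IsFilteredBilin H B) (i j : ℕ) :
    GradedPiece H i →ₗ[ℝ] GradedPiece H j →ₗ[ℝ] GradedPiece H (i + j) :=
  Submodule.liftQ _
    { toFun := h.pieceAux i j
      map_add' := fun v v' => by
        refine Submodule.linearMap_qext _ (LinearMap.ext fun w => ?_)
        exact (mk_congr (v := ⟨B (v + v').1 w.1, h.mem (v + v').2 w.2⟩)
          (w := ⟨B v.1 w.1, h.mem v.2 w.2⟩ + ⟨B v'.1 w.1, h.mem v'.2 w.2⟩) (by simp)).trans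
          (map_add _ _ _)
      map_smul' := fun c v => by
        refine Submodule.linearMap_qext _ (LinearMap.ext fun w => ?_)
        exact (mk_congr (v := ⟨B (c • v).1 w.1, h.mem (c • v).2 w.2⟩)
          (w := c • ⟨B v.1 w.1, h.mem v.2 w.2⟩) (by simp)).trans (map_smul _ _ _) }
    (fun v hv => by
      rw [LinearMap.mem_ker]
      refine Submodule.linearMap_qext _ (LinearMap.ext fun w => ?_)
      exact (Submodule.Quotient.mk_eq_zero _).2 (h.mem_left hv w.2))

/-- The bilinear map induced on the associated graded space. -/
def graded (h : IsFilteredBilin H B) : AssocGraded H →ₗ[ℝ] AssocGraded H →ₗ[ℝ] AssocGraded H :=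
  DirectSum.toModule ℝ ℕ _ fun i => LinearMap.flip <| DirectSum.toModule ℝ ℕ _ fun j =>
    ((h.piece i j).compr₂ (DirectSum.lof ℝ ℕ (fun i => GradedPiece H i) (i + j))).flip

theorem graded_class (h : IsFilteredBilin H B) {i j : ℕ} (v : H i) (w : H j) :
    h.graded (gradedClass H i v) (gradedClass H j w) =
      gradedClass H (i + j) ⟨B v.1 w.1, h.mem v.2 w.2⟩ := by
  simp only [graded, gradedClass, LinearMap.comp_apply, DirectSum.toModule_lof,
    LinearMap.flip_apply, LinearMap.compr₂_apply]
  rfl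

end IsFilteredBilin

theorem gradedClass_congr {H : ℕ → Submodule ℝ T} {i j : ℕ} (hij : i = j) {v w : T}
    (hv : v ∈ H i) (hw : w ∈ H j) (hvw : v - w ∈ H (i - 1)) :
    gradedClass H i ⟨v, hv⟩ = gradedClass H j ⟨w, hw⟩ := by
  subst hij
  simp only [gradedClass, LinearMap.comp_apply, Submodule.mkQ_apply]
  congr 1
  exact (Submodule.Quotient.eq _).2 hvw

theorem assocGraded_induction {H : ℕ → Submodule ℝ T} {p : AssocGraded H → Prop}
    (h0 : p 0) (hc : ∀ i v, p (gradedClass H i v)) (ha : ∀ a b, p a → p b → p (a + b))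
    (a : AssocGraded H) : p a := by
  induction a using DirectSum.induction_on with
  | zero => exact h0
  | of i v =>
    obtain ⟨v, rfl⟩ := Submodule.Quotient.mk_surjective _ v
    exact hc i v
  | add a b h1 h2 => exact ha a b h1 h2

theorem graded_self {H : ℕ → Submodule ℝ T} {B : T →ₗ[ℝ] T →ₗ[ℝ] T} (h : IsFilteredBilin H B)
    (hB : ∀ v w, B v w = -B w v) (a : AssocGraded H) : h.graded a a = 0 := by
  have skew : ∀ a b, h.graded a b = -h.graded b a := by
    intro a b
    induction a using assocGraded_induction with
    | h0 => simp
    | ha a a' h1 h2 => simp only [map_add, LinearMap.add_apply, h1, h2]; abel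
    | hc i v =>
      induction b using assocGraded_induction with
      | h0 => simp
      | ha b b' h1 h2 => simp only [map_add, LinearMap.add_apply, h1, h2]; abel
      | hc j w =>
        rw [h.graded_class, h.graded_class, ← map_neg]
        exact gradedClass_congr (add_comm i j) _ (Submodule.neg_mem _ (h.mem w.2 v.2))
          (by simp [hB v.1 w.1])
  have h1 := skew a a
  have h2 : (2 : ℝ) • h.graded a a = 0 := by
    rw [two_smul]; nth_rewrite 1 [h1]; simp
  exact (smul_eq_zero.1 h2).resolve_left (by norm_num)

theorem graded_leibniz {H : ℕ → Submodule ℝ T} {B : T →ₗ[ℝ] T →ₗ[ℝ] T} (h : IsFilteredBilin H B)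
    (hJ : ∀ {i j k : ℕ} {u v w : T}, u ∈ H i → v ∈ H j → w ∈ H k →
      B u (B v w) - (B (B u v) w + B v (B u w)) ∈ H (i + j + k - 1)) (a b c : AssocGraded H) :
    h.graded a (h.graded b c) = h.graded (h.graded a b) c + h.graded b (h.graded a c) := by
  induction a using assocGraded_induction with
  | h0 => simp
  | ha a a' h1 h2 => simp only [map_add, LinearMap.add_apply, h1, h2]; abel
  | hc i u =>
    induction b using assocGraded_induction with
    | h0 => simp
    | ha b b' h1 h2 => simp only [map_add, LinearMap.add_apply, h1, h2]; abel
    | hc j v =>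
      induction c using assocGraded_induction with
      | h0 => simp
      | ha c c' h1 h2 => simp only [map_add, h1, h2]; abel
      | hc k w =>
        simp only [h.graded_class]
        have e : i + j + k = j + (i + k) := by omega
        have e' : i + (j + k) = i + j + k := by omega
        have m1 := h.mem (h.mem u.2 v.2) w.2
        have m2 := h.mem v.2 (h.mem u.2 w.2)
        have m2' : B v (B u w) ∈ H (i + j + k) := by rw [e]; exact m2
        rw [gradedClass_congr e.symm m2 m2' (by simp), ← map_add]
        exact gradedClass_congr e' _ (Submodule.add_mem _ m1 m2')
          (by rw [e']; exact hJ u.2 v.2 w.2)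

end GradedBracket

section Frames

variable {E : Type*} [NormedAddCommGroup E] [NormedSpace ℝ E] [FiniteDimensional ℝ E]
  {M : Type*} [TopologicalSpace M] [ChartedSpace E M] [IsManifold 𝓘(ℝ, E) ∞ M]
  {ι : Type*} [Fintype ι] {s : ι → ∀ y : M, TangentSpace 𝓘(ℝ, E) y} {u : Set M} {x : M}

/-- The coefficients of a smooth vector field in a smooth local frame are smooth. -/
theorem contMDiffAt_frame_coeff (hs : IsLocalFrameOn 𝓘(ℝ, E) E ∞ s u) (hu : u ∈ nhds x)
    {Z : ∀ y : M, TangentSpace 𝓘(ℝ, E) y} (hZ : CMDiffAt ∞ (T% Z) x) (a : ι) :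
    ContMDiffAt 𝓘(ℝ, E) 𝓘(ℝ) ∞ (fun y => hs.coeff a y (Z y)) x := by
  classical
  have hx := mem_of_mem_nhds hu
  let e := trivializationAt E (TangentSpace 𝓘(ℝ, E)) x
  have hxe : x ∈ e.baseSet := FiberBundle.mem_baseSet_trivializationAt' x
  have hZ' := (Bundle.contMDiffAt_section x).1 hZ
  have hs' : ∀ b, ContMDiffAt 𝓘(ℝ, E) 𝓘(ℝ, E) ∞ (fun y => (e ⟨y, s b y⟩).2) x := fun b =>
    (Bundle.contMDiffAt_section x).1 ((hs.contMDiffOn b).contMDiffAt hu)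
  let S : M → ((ι → ℝ) →L[ℝ] E) := fun y =>
    ∑ b, (ContinuousLinearMap.proj (R := ℝ) (φ := fun _ : ι => ℝ) b).smulRight (e ⟨y, s b y⟩).2
  have hS : ContMDiffAt 𝓘(ℝ, E) 𝓘(ℝ, (ι → ℝ) →L[ℝ] E) ∞ S x := by
    refine contMDiffAt_finsetSum fun b _ => ?_
    exact ((ContinuousLinearMap.smulRightL ℝ (ι → ℝ) E
      (ContinuousLinearMap.proj (R := ℝ) (φ := fun _ : ι => ℝ) b)).contDiff.contDiffAt).comp_contMDiffAt
      (hs' b)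
  have key : ∀ y, ∀ hy : y ∈ u, y ∈ e.baseSet →
      ∃ T : (ι → ℝ) ≃L[ℝ] E, (T : (ι → ℝ) →L[ℝ] E) = S y ∧
        ∀ v : TangentSpace 𝓘(ℝ, E) y, ∀ b, T.symm (e ⟨y, v⟩).2 b = hs.coeff b y v := by
    intro y hy hye
    let L : TangentSpace 𝓘(ℝ, E) y ≃ₗ[ℝ] E := e.linearEquivAt ℝ y hye
    have hL : ∀ v, L v = (e ⟨y, v⟩).2 := fun v => rfl
    let T : (ι → ℝ) ≃ₗ[ℝ] E := (hs.toBasisAt hy).equivFun.symm ≪≫ₗ L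
    refine ⟨T.toContinuousLinearEquiv, ?_, fun v b => ?_⟩
    · ext1 c
      change L ((hs.toBasisAt hy).equivFun.symm c) = S y c
      rw [Module.Basis.equivFun_symm_apply, map_sum]
      have h0 : S y c = ∑ b, c b • L (s b y) := by simp [S, hL]
      rw [h0]
      exact Finset.sum_congr rfl fun b _ => by rw [map_smul, hs.toBasisAt_coe]
    · change (hs.toBasisAt hy).equivFun (L.symm (e ⟨y, v⟩).2) b = _
      rw [← hL, LinearEquiv.symm_apply_apply]
      simp [IsLocalFrameOn.coeff, hy]
  obtain ⟨T, hT, -⟩ := key x hx hxe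
  have hinv : ContMDiffAt 𝓘(ℝ, E) 𝓘(ℝ, E →L[ℝ] (ι → ℝ)) ∞
      (fun y => ContinuousLinearMap.inverse (S y)) x := by
    have h0 : ContDiffAt ℝ ∞ (ContinuousLinearMap.inverse : ((ι → ℝ) →L[ℝ] E) → _) (S x) := by
      rw [← hT]; exact contDiffAt_map_inverse T
    exact h0.comp_contMDiffAt hS
  have h1 := hinv.clm_apply hZ'
  have h2 := ((ContinuousLinearMap.proj (R := ℝ) (φ := fun _ : ι => ℝ) a).contDiff.contDiffAt
    (n := ∞)).comp_contMDiffAt h1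
  refine h2.congr_of_eventuallyEq ?_
  filter_upwards [hu, e.open_baseSet.mem_nhds hxe] with y hy hye
  obtain ⟨T, hT, hT'⟩ := key y hy hye
  simp only [Function.comp, ← hT, ContinuousLinearMap.inverse_equiv]
  exact (hT' (Z y) a).symm

theorem mlieBracket_sum_left {κ : Type*} (A : Finset κ) {X : κ → ∀ y : M, TangentSpace 𝓘(ℝ, E) y}
    {W : ∀ y : M, TangentSpace 𝓘(ℝ, E) y} (hX : ∀ a, CMDiffAt ∞ (T% (X a)) x) :
    mlieBracket 𝓘(ℝ, E) (fun y => ∑ a ∈ A, X a y) W x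
      = ∑ a ∈ A, mlieBracket 𝓘(ℝ, E) (X a) W x := by
  classical
  induction A using Finset.induction_on with
  | empty =>
    simp only [Finset.sum_empty]
    exact congrFun (mlieBracket_zero_left (I := 𝓘(ℝ, E)) (W := W)) x
  | insert a A ha ih =>
    simp only [Finset.sum_insert ha]
    rw [← ih]
    exact mlieBracket_add_left ((hX a).mdifferentiableAt (by simp))
      ((ContMDiffAt.sum_section fun b _ => hX b).mdifferentiableAt (by simp))

/-- If a local section `Z` of the bundle spanned by some of the members of a local frame vanishes at
`x`, then its brackets at `x` belong to that bundle. -/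
theorem mlieBracket_mem_span (hs : IsLocalFrameOn 𝓘(ℝ, E) E ∞ s u) (hu : u ∈ nhds x) (A : Set ι)
    {Z W : ∀ y : M, TangentSpace 𝓘(ℝ, E) y} (hZ : CMDiffAt ∞ (T% Z) x)
    (hZA : ∀ᶠ y in nhds x, Z y ∈ Submodule.span ℝ ((s · y) '' A)) (hZ0 : Z x = 0) :
    mlieBracket 𝓘(ℝ, E) Z W x ∈ Submodule.span ℝ ((s · x) '' A) := by
  classical
  let f : ι → M → ℝ := fun a y => hs.coeff a y (Z y)
  have hf : ∀ a, ContMDiffAt 𝓘(ℝ, E) 𝓘(ℝ) ∞ (f a) x := contMDiffAt_frame_coeff hs hu hZ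
  have hsa : ∀ a, CMDiffAt ∞ (T% (s a)) x := fun a => (hs.contMDiffOn a).contMDiffAt hu
  have h1 : Z =ᶠ[nhds x] fun y => ∑ a, (f a • s a) y :=
    hs.eventually_eq_sum_coeff_smul Z hu
  have h3 : mlieBracket 𝓘(ℝ, E) Z W x =
      mlieBracket 𝓘(ℝ, E) (fun y => ∑ a, (f a • s a) y) W x :=
    h1.mlieBracket_vectorField_eq Filter.EventuallyEq.rfl
  rw [h3, mlieBracket_sum_left _ fun a => (hf a).smul_section (hsa a)]
  refine Submodule.sum_mem _ fun a _ => ?_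
  rw [mlieBracket_smul_left ((hf a).mdifferentiableAt (by simp))
    ((hsa a).mdifferentiableAt (by simp))]
  have h0 : f a x = 0 := by simp [f, hZ0]
  rw [h0, zero_smul, add_zero]
  by_cases ha : a ∈ A
  · exact Submodule.smul_mem _ _ (Submodule.subset_span ⟨a, ha, rfl⟩)
  · have : f a =ᶠ[nhds x] fun _ => (0 : ℝ) := by
      filter_upwards [hu, hZA] with y hy hyA
      have hb : (fun b => s b y) = hs.toBasisAt hy := by ext1 b; simp
      have hyA' : Z y ∈ Submodule.span ℝ ((hs.toBasisAt hy) '' A) := by rw [← hb]; exact hyA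
      have := (Module.Basis.mem_span_image _).1 hyA'
      simp only [f, IsLocalFrameOn.coeff_apply_of_mem hs hy]
      by_contra hne
      exact ha (this (Finsupp.mem_support_iff.2 hne))
    have h2 : mvfderiv 𝓘(ℝ, E) (f a) x = 0 := by
      rw [mvfderiv, this.mfderiv_eq, mfderiv_const]
      exact ContinuousLinearMap.comp_zero _
    simp [h2]

end Frames

section Filtration

variable (E : Type*) [NormedAddCommGroup E] [NormedSpace ℝ E]
  (M : Type*) [TopologicalSpace M] [ChartedSpace E M] [IsManifold 𝓘(ℝ, E) ∞ M]

/-- A filtration `0 = H 0 ⊆ H 1 ⊆ ⋯ ⊆ H n = TM` of the tangent bundle of a smooth manifold by smooth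
subbundles, with `[Γ(H i), Γ(H j)] ⊆ Γ(H (i + j))`. The subbundles are described by smooth local
frames of the tangent bundle which are adapted to the filtration; brackets are controlled for all
local smooth sections. -/
structure TangentFiltration where
  /-- the members of the filtration -/
  H : ℕ → ∀ y : M, Submodule ℝ (TangentSpace 𝓘(ℝ, E) y)
  /-- the number of steps -/
  depth : ℕ
  H_zero : ∀ y, H 0 y = ⊥
  mono : ∀ y, Monotone fun i => H i y
  H_of_depth_le : ∀ i, depth ≤ i → ∀ y, H i y = ⊤
  exists_frame : ∀ x : M, ∃ (u : Set M)
    (s : Fin (Module.finrank ℝ E) → ∀ y : M, TangentSpace 𝓘(ℝ, E) y)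
    (w : Fin (Module.finrank ℝ E) → ℕ), IsOpen u ∧ x ∈ u ∧ IsLocalFrameOn 𝓘(ℝ, E) E ∞ s u ∧
      ∀ y ∈ u, ∀ i, H i y = Submodule.span ℝ ((s · y) '' {a | w a ≤ i})
  mlieBracket_mem : ∀ (i j : ℕ) (u : Set M), IsOpen u →
    ∀ X Y : ∀ y : M, TangentSpace 𝓘(ℝ, E) y, CMDiff[u] ∞ (T% X) → CMDiff[u] ∞ (T% Y) →
      (∀ y ∈ u, X y ∈ H i y) → (∀ y ∈ u, Y y ∈ H j y) →
      ∀ y ∈ u, mlieBracket 𝓘(ℝ, E) X Y y ∈ H (i + j) y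

namespace TangentFiltration

variable {E M} [FiniteDimensional ℝ E] (F : TangentFiltration E M) (x : M)

/-- The domain of a chosen adapted frame near `x`. -/
def nbhd : Set M := (F.exists_frame x).choose

/-- A chosen adapted frame near `x`. -/
def frame : Fin (Module.finrank ℝ E) → ∀ y : M, TangentSpace 𝓘(ℝ, E) y :=
  (F.exists_frame x).choose_spec.choose

/-- The orders of the members of the chosen adapted frame near `x`. -/
def weight : Fin (Module.finrank ℝ E) → ℕ :=
  (F.exists_frame x).choose_spec.choose_spec.choose

theorem isOpen_nbhd : IsOpen (F.nbhd x) :=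
  (F.exists_frame x).choose_spec.choose_spec.choose_spec.1

theorem mem_nbhd : x ∈ F.nbhd x :=
  (F.exists_frame x).choose_spec.choose_spec.choose_spec.2.1

theorem isLocalFrameOn : IsLocalFrameOn 𝓘(ℝ, E) E ∞ (F.frame x) (F.nbhd x) :=
  (F.exists_frame x).choose_spec.choose_spec.choose_spec.2.2.1

theorem H_eq_span {y : M} (hy : y ∈ F.nbhd x) (i : ℕ) :
    F.H i y = Submodule.span ℝ ((F.frame x · y) '' {a | F.weight x a ≤ i}) :=
  (F.exists_frame x).choose_spec.choose_spec.choose_spec.2.2.2 y hy i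

theorem nbhd_mem : F.nbhd x ∈ nhds x := (F.isOpen_nbhd x).mem_nhds (F.mem_nbhd x)

variable {F x}

variable (F x) in
/-- `X` is a smooth section of `H i` near `x`. -/
def IsSectionNear (i : ℕ) (X : ∀ y : M, TangentSpace 𝓘(ℝ, E) y) : Prop :=
  ∀ᶠ y in nhds x, CMDiffAt ∞ (T% X) y ∧ X y ∈ F.H i y

namespace IsSectionNear

variable {i j : ℕ} {X Y X' Y' : ∀ y : M, TangentSpace 𝓘(ℝ, E) y}

theorem smooth (hX : F.IsSectionNear x i X) : CMDiffAt ∞ (T% X) x := hX.self_of_nhds.1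

theorem mem_self (hX : F.IsSectionNear x i X) : X x ∈ F.H i x := hX.self_of_nhds.2

theorem mdiff (hX : F.IsSectionNear x i X) : MDiffAt (T% X) x :=
  hX.smooth.mdifferentiableAt (by simp)

theorem bracket (hX : F.IsSectionNear x i X) (hY : F.IsSectionNear x j Y) :
    F.IsSectionNear x (i + j) (mlieBracket 𝓘(ℝ, E) X Y) := by
  obtain ⟨v, hv, hvo, hxv⟩ := eventually_nhds_iff.1 (hX.and hY)
  refine eventually_nhds_iff.2 ⟨v, fun y hy => ⟨?_, ?_⟩, hvo, hxv⟩
  · have : IsManifold 𝓘(ℝ, E) (((⊤ : ℕ∞) : WithTop ℕ∞) + 1) M :=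
      inferInstanceAs (IsManifold 𝓘(ℝ, E) ∞ M)
    refine ContMDiffAt.mlieBracket_vectorField (m := ⊤) (n := ⊤) (hv y hy).1.1 (hv y hy).2.1 ?_
    rw [minSmoothness_of_isRCLikeNormedField]
    exact le_rfl
  · exact F.mlieBracket_mem i j v hvo X Y (fun z hz => (hv z hz).1.1.contMDiffWithinAt)
      (fun z hz => (hv z hz).2.1.contMDiffWithinAt) (fun z hz => (hv z hz).1.2)
      (fun z hz => (hv z hz).2.2) y hy

theorem sub (hX : F.IsSectionNear x i X) (hX' : F.IsSectionNear x i X') :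
    F.IsSectionNear x i (X - X') := by
  filter_upwards [hX, hX'] with y h1 h2
  exact ⟨h1.1.sub_section h2.1, Submodule.sub_mem _ h1.2 h2.2⟩

theorem eventually_zero (hX : F.IsSectionNear x 0 X) : X =ᶠ[nhds x] 0 := by
  filter_upwards [hX] with y hy
  have := hy.2
  rw [F.H_zero, Submodule.mem_bot] at this
  exact this

theorem bracket_mem_of_eq_zero (hX : F.IsSectionNear x i X) (h0 : X x = 0)
    (Y : ∀ y : M, TangentSpace 𝓘(ℝ, E) y) : mlieBracket 𝓘(ℝ, E) X Y x ∈ F.H i x := by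
  rw [F.H_eq_span x (F.mem_nbhd x)]
  refine mlieBracket_mem_span (F.isLocalFrameOn x) (F.nbhd_mem x) _ hX.smooth ?_ h0
  filter_upwards [hX, F.nbhd_mem x] with y h1 h2
  rw [← F.H_eq_span x h2]
  exact h1.2

theorem bracket_left_congr (hX : F.IsSectionNear x i X) (hX' : F.IsSectionNear x i X')
    (hY : F.IsSectionNear x j Y) (h : X x = X' x) :
    mlieBracket 𝓘(ℝ, E) X Y x - mlieBracket 𝓘(ℝ, E) X' Y x ∈ F.H (i + j - 1) x := by
  have e : X = X' + (X - X') := by abel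
  have hd := hX.sub hX'
  have e1 : mlieBracket 𝓘(ℝ, E) X Y x =
      mlieBracket 𝓘(ℝ, E) X' Y x + mlieBracket 𝓘(ℝ, E) (X - X') Y x := by
    conv_lhs => rw [e]
    exact mlieBracket_add_left hX'.mdiff hd.mdiff
  rw [e1, add_sub_cancel_left]
  rcases j with _ | j
  · have : mlieBracket 𝓘(ℝ, E) (X - X') Y x = mlieBracket 𝓘(ℝ, E) (X - X') 0 x :=
      Filter.EventuallyEq.rfl.mlieBracket_vectorField_eq hY.eventually_zero
    rw [this, mlieBracket_zero_right]
    exact Submodule.zero_mem _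
  · exact F.mono x (by omega : i ≤ i + (j + 1) - 1)
      (hd.bracket_mem_of_eq_zero (by simp [h]) Y)

/-- The bracket of sections of `H i` and `H j` at `x` depends only on the values of these
sections at `x`, up to elements of `H (i + j - 1)`. -/
theorem bracket_congr (hX : F.IsSectionNear x i X) (hX' : F.IsSectionNear x i X')
    (hY : F.IsSectionNear x j Y) (hY' : F.IsSectionNear x j Y') (h : X x = X' x)
    (h' : Y x = Y' x) :
    mlieBracket 𝓘(ℝ, E) X Y x - mlieBracket 𝓘(ℝ, E) X' Y' x ∈ F.H (i + j - 1) x := by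
  have h1 := hX.bracket_left_congr hX' hY h
  have h2 := hY.bracket_left_congr hY' hX' h'
  rw [mlieBracket_swap_apply (V := Y), mlieBracket_swap_apply (V := Y'), add_comm j i] at h2
  have := Submodule.add_mem _ h1 (Submodule.neg_mem _ h2)
  convert! this using 1
  abel

end IsSectionNear

variable (F x) in
/-- The local vector field with value `v` at `x` whose coefficients in the chosen adapted frame are
constant. -/
def extend (v : TangentSpace 𝓘(ℝ, E) x) (y : M) : TangentSpace 𝓘(ℝ, E) y :=
  ∑ a, (F.isLocalFrameOn x).coeff a x v • F.frame x a y

theorem extend_self (v : TangentSpace 𝓘(ℝ, E) x) : F.extend x v x = v := by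
  have := Module.Basis.sum_repr ((F.isLocalFrameOn x).toBasisAt (F.mem_nbhd x)) v
  simpa [extend, IsLocalFrameOn.coeff, F.mem_nbhd x] using! this

theorem extend_add (v w : TangentSpace 𝓘(ℝ, E) x) :
    F.extend x (v + w) = F.extend x v + F.extend x w := by
  funext y; simp [extend, add_smul, Finset.sum_add_distrib]

theorem extend_smul (c : ℝ) (v : TangentSpace 𝓘(ℝ, E) x) :
    F.extend x (c • v) = c • F.extend x v := by
  funext y; simp [extend, mul_smul, Finset.smul_sum]

theorem isSectionNear_extend {i : ℕ} {v : TangentSpace 𝓘(ℝ, E) x} (hv : v ∈ F.H i x) :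
    F.IsSectionNear x i (F.extend x v) := by
  filter_upwards [(F.isOpen_nbhd x).mem_nhds (F.mem_nbhd x)] with y hy
  refine ⟨ContMDiffAt.sum_section fun a _ => ContMDiffAt.const_smul_section
    (((F.isLocalFrameOn x).contMDiffOn a).contMDiffAt ((F.isOpen_nbhd x).mem_nhds hy)), ?_⟩
  rw [F.H_eq_span x hy]
  refine Submodule.sum_mem _ fun a _ => ?_
  by_cases ha : F.weight x a ≤ i
  · exact Submodule.smul_mem _ _ (Submodule.subset_span ⟨a, ha, rfl⟩)
  · have : (F.isLocalFrameOn x).coeff a x v = 0 := by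
      have hb : (fun b => F.frame x b x) = (F.isLocalFrameOn x).toBasisAt (F.mem_nbhd x) := by
        ext1 b; simp
      rw [F.H_eq_span x (F.mem_nbhd x)] at hv
      have hv' : v ∈ Submodule.span ℝ
          (((F.isLocalFrameOn x).toBasisAt (F.mem_nbhd x)) '' {a | F.weight x a ≤ i}) := by
        rw [← hb]; exact hv
      have := (Module.Basis.mem_span_image _).1 hv'
      simp only [IsLocalFrameOn.coeff, dif_pos (F.mem_nbhd x)]
      by_contra hne
      exact ha (this (Finsupp.mem_support_iff.2 hne))
    rw [this, zero_smul]
    exact Submodule.zero_mem _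

theorem mdiff_extend (v : TangentSpace 𝓘(ℝ, E) x) : MDiffAt (T% (F.extend x v)) x :=
  (isSectionNear_extend (i := F.depth) (F := F) (v := v)
    (by rw [F.H_of_depth_le _ le_rfl]; trivial)).mdiff

variable (F x) in
/-- The bracket at `x` of the extensions of two tangent vectors. -/
def preBracket : TangentSpace 𝓘(ℝ, E) x →ₗ[ℝ] TangentSpace 𝓘(ℝ, E) x →ₗ[ℝ]
    TangentSpace 𝓘(ℝ, E) x :=
  LinearMap.mk₂ ℝ (fun v w => mlieBracket 𝓘(ℝ, E) (F.extend x v) (F.extend x w) x)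
    (fun v v' w => by
      rw [extend_add, mlieBracket_add_left (mdiff_extend v) (mdiff_extend v')])
    (fun c v w => by rw [extend_smul, mlieBracket_const_smul_left (mdiff_extend v)])
    (fun v w w' => by
      rw [extend_add, mlieBracket_add_right (mdiff_extend w) (mdiff_extend w')])
    (fun c v w => by rw [extend_smul, mlieBracket_const_smul_right (mdiff_extend w)])

theorem preBracket_apply (v w : TangentSpace 𝓘(ℝ, E) x) :
    F.preBracket x v w = mlieBracket 𝓘(ℝ, E) (F.extend x v) (F.extend x w) x := rfl

theorem preBracket_swap (v w : TangentSpace 𝓘(ℝ, E) x) :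
    F.preBracket x v w = -F.preBracket x w v :=
  mlieBracket_swap_apply

theorem isFilteredBilin : IsFilteredBilin (fun i => F.H i x) (F.preBracket x) where
  zero := F.H_zero x
  mono := F.mono x
  mem hv hw := ((isSectionNear_extend hv).bracket (isSectionNear_extend hw)).mem_self

theorem preBracket_congr {i j : ℕ} {X Y : ∀ y : M, TangentSpace 𝓘(ℝ, E) y}
    (hX : F.IsSectionNear x i X) (hY : F.IsSectionNear x j Y) :
    F.preBracket x (X x) (Y x) - mlieBracket 𝓘(ℝ, E) X Y x ∈ F.H (i + j - 1) x :=
  (isSectionNear_extend hX.mem_self).bracket_congr hX (isSectionNear_extend hY.mem_self) hY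
    (extend_self _) (extend_self _)

theorem preBracket_jacobi {i j k : ℕ} {u v w : TangentSpace 𝓘(ℝ, E) x} (hu : u ∈ F.H i x)
    (hv : v ∈ F.H j x) (hw : w ∈ F.H k x) :
    F.preBracket x u (F.preBracket x v w) - (F.preBracket x (F.preBracket x u v) w +
      F.preBracket x v (F.preBracket x u w)) ∈ F.H (i + j + k - 1) x := by
  have su := isSectionNear_extend hu
  have sv := isSectionNear_extend hv
  have sw := isSectionNear_extend hw
  have h1 := preBracket_congr su (sv.bracket sw)
  have h2 := preBracket_congr (su.bracket sv) sw
  have h3 := preBracket_congr sv (su.bracket sw)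
  have hs : ∀ {l : ℕ} {X : ∀ y : M, TangentSpace 𝓘(ℝ, E) y}, F.IsSectionNear x l X →
      CMDiffAt (minSmoothness ℝ 2) (T% X) x := fun hX =>
    hX.smooth.of_le (by
      rw [minSmoothness_of_isRCLikeNormedField]
      exact (ENat.LEInfty.out : (2 : WithTop ℕ∞) ≤ ((⊤ : ℕ∞) : WithTop ℕ∞)))
  have h4 := leibniz_identity_mlieBracket_apply (hs su) (hs sv) (hs sw)
  simp only [extend_self, ← preBracket_apply] at h1 h2 h3
  rw [h4, show i + (j + k) - 1 = i + j + k - 1 by omega] at h1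
  rw [show j + (i + k) - 1 = i + j + k - 1 by omega] at h3
  have := Submodule.sub_mem _ h1 (Submodule.add_mem _ h2 h3)
  convert! this using 1
  abel

variable (F x)

/-- The osculating Lie algebra `gr(H)_x = ⨁ i, (H i / H (i - 1))_x` of a filtered manifold. -/
def Gr : Type _ := AssocGraded fun i => F.H i x

instance : AddCommGroup (F.Gr x) := inferInstanceAs (AddCommGroup (AssocGraded fun i => F.H i x))

instance : Module ℝ (F.Gr x) := inferInstanceAs (Module ℝ (AssocGraded fun i => F.H i x))

/-- The class in degree `i` of a vector in `H i`. -/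
def toGr (i : ℕ) : F.H i x →ₗ[ℝ] F.Gr x := gradedClass (fun i => F.H i x) i

/-- The Lie bracket of the osculating Lie algebra. -/
def grBracket : F.Gr x →ₗ[ℝ] F.Gr x →ₗ[ℝ] F.Gr x :=
  (isFilteredBilin (F := F) (x := x)).graded

instance : LieRing (F.Gr x) where
  bracket a b := F.grBracket x a b
  add_lie a b c := by change F.grBracket x (a + b) c = _; rw [map_add]; rfl
  lie_add a b c := map_add (F.grBracket x a) b c
  lie_self a := graded_self isFilteredBilin preBracket_swap a
  leibniz_lie a b c := graded_leibniz isFilteredBilin preBracket_jacobi a b c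

instance : LieAlgebra ℝ (F.Gr x) where
  lie_smul c a b := map_smul (F.grBracket x a) c b

/-- The bracket of the osculating Lie algebra is induced by the bracket of vector fields: for sections
`X` of `H i` and `Y` of `H j`, the bracket of the class of `X x` in degree `i` with the class of `Y x`
in degree `j` is the class of `[X, Y] x` in degree `i + j`. -/
theorem lie_toGr {i j : ℕ} {X Y : ∀ y : M, TangentSpace 𝓘(ℝ, E) y}
    (hX : F.IsSectionNear x i X) (hY : F.IsSectionNear x j Y) :
    ⁅F.toGr x i ⟨X x, hX.mem_self⟩, F.toGr x j ⟨Y x, hY.mem_self⟩⁆ =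
      F.toGr x (i + j) ⟨mlieBracket 𝓘(ℝ, E) X Y x, (hX.bracket hY).mem_self⟩ :=
  ((isFilteredBilin (F := F) (x := x)).graded_class _ _).trans
    (gradedClass_congr rfl _ _ (preBracket_congr hX hY))

end TangentFiltration

end Filtration

section Dirac

variable {L : Type*} [LieRing L] [LieAlgebra ℝ L]
  {V : Type*} [NormedAddCommGroup V] [InnerProductSpace ℝ V] {ι : Type*} [Fintype ι]

/-- The element `-i ∑ k, X k ⊗ (ext (e k) + int (e k))` of `U(L) ⊗ End (Λ V)`. -/
def diracElement (X : ι → L) (e : ι → V) :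
    ComplexEnveloping L ⊗[ℝ] Module.End ℝ (ExteriorAlgebra ℝ V) :=
  ∑ k, ((-Complex.I) ⊗ₜ[ℝ] UniversalEnvelopingAlgebra.ι ℝ (X k)) ⊗ₜ[ℝ] (extMul (e k) + intMul (e k))

/-- For the images `a k` in `V` of an orthonormal basis under a linear map `f`, the vectors
`e k = (f f^*)^(-1/2) (a k)`, where `(f f^*)^(1/2)` is inverted on the range of `f`. Here
`f f^* ξ = ∑ k, ⟪a k, ξ⟫ a k`. -/
def IsPolarDual (a e : ι → V) : Prop :=
  ∃ Φ : V →ₗ[ℝ] V, Φ.IsPositive ∧ (∀ ξ, Φ (Φ ξ) = ∑ k, inner ℝ (a k) ξ • a k) ∧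
    ∀ k, e k ∈ Submodule.span ℝ (Set.range a) ∧ Φ (e k) = a k

variable {E : Type*} [NormedAddCommGroup E] [NormedSpace ℝ E] [FiniteDimensional ℝ E]
  {G : Type*} [TopologicalSpace G] [ChartedSpace E G] [Group G] [LieGroup 𝓘(ℝ, E) ∞ G]
  [MeasurableSpace G] [BorelSpace G]

/-- Formal self-adjointness of an element of `U(L) ⊗ End (Λ V)`, where `L` is (through `φ`) the Lie
algebra of `G`, in each of the pictures for adjoints: in the enveloping algebra, for the distributions
at the identity, for the left and for the right Hilbert `C^*(G)`-module `C^*(G) ⊗ Λ V`, and for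
the `L^2` inner product. -/
structure FormallySelfAdjoint (φ : L →ₗ⁅ℝ⁆ GroupLieAlgebra 𝓘(ℝ, E) G) (μ : Measure G)
    [IsFiniteMeasureOnCompacts μ]
    (S : ComplexEnveloping L ⊗[ℝ] Module.End ℝ (ExteriorAlgebra ℝ V)) : Prop where
  envelope : ∀ a b : ExteriorAlgebra ℝ V, envAdjoint L (matrixCoeff a b S) = matrixCoeff b a S
  distribution : ∀ a b : ExteriorAlgebra ℝ V,
    (TestFun.kernelAtOne (leftInvOp φ (matrixCoeff a b S))).star =
      TestFun.kernelAtOne (leftInvOp φ (matrixCoeff b a S))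
  leftModule : ∀ f k : TestFun E G ⊗[ℝ] ExteriorAlgebra ℝ V,
    tensorForm (cstarForm μ) (matrixOp φ S f) k = tensorForm (cstarForm μ) f (matrixOp φ S k)
  rightModule : ∀ f k : TestFun E G ⊗[ℝ] ExteriorAlgebra ℝ V,
    tensorForm (cstarFormRight μ) (matrixOpRight φ S f) k =
      tensorForm (cstarFormRight μ) f (matrixOpRight φ S k)
  l2 : ∀ f k : TestFun E G ⊗[ℝ] ExteriorAlgebra ℝ V,
    tensorForm (l2Form μ) (matrixOp φ S f) k = tensorForm (l2Form μ) f (matrixOp φ S k)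

end Dirac

section Orbital

variable {E : Type*} [NormedAddCommGroup E] [NormedSpace ℝ E]
  {M : Type*} [TopologicalSpace M] [ChartedSpace E M]
  {E' : Type*} [NormedAddCommGroup E'] [NormedSpace ℝ E']
  (K : Type*) [TopologicalSpace K] [ChartedSpace E' K] [Group K] [MulAction K M]

/-- The derivative at the identity of the orbit map `k ↦ k • x`, from the Lie algebra of `K` to the
tangent space at `x`. -/
def orbitDeriv (x : M) : GroupLieAlgebra 𝓘(ℝ, E') K →ₗ[ℝ] TangentSpace 𝓘(ℝ, E) x :=
  (mfderiv 𝓘(ℝ, E') 𝓘(ℝ, E) (fun k : K => k • x) (1 : K)).toLinearMap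

variable {ι : Type*} [Fintype ι] [FiniteDimensional ℝ E] [IsManifold 𝓘(ℝ, E) ∞ M]
  [RiemannianBundle (fun y : M => TangentSpace 𝓘(ℝ, E) y)]

/-- The cosymbol at `x`, in Heisenberg order `m`, of a first order operator with leading part
`-i ∑ k, (ext (e k) + int (e k)) ∂/∂(v k)`, where `∂/∂(v k)` is the vector field generated by `v k`: this field
is replaced by its class in degree `m` of the osculating Lie algebra. The orbital Dirac operator is the case in
which the `v k` are an orthonormal basis and `IsPolarDual` holds. -/
def orbitalCosymbol (F : TangentFiltration E M) (x : M) (m : ℕ)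
    (v : ι → GroupLieAlgebra 𝓘(ℝ, E') K) (hv : ∀ k, orbitDeriv K x (v k) ∈ F.H m x)
    (e : ι → TangentSpace 𝓘(ℝ, E) x) :
    ComplexEnveloping (F.Gr x) ⊗[ℝ] Module.End ℝ (ExteriorAlgebra ℝ (TangentSpace 𝓘(ℝ, E) x)) :=
  diracElement (fun k => F.toGr x m ⟨orbitDeriv K x (v k), hv k⟩) e

end Orbital

end

/-! ### Differentiation along curves in manifolds -/

section Curves

variable {E : Type*} [NormedAddCommGroup E] [NormedSpace ℝ E]
  {F : Type*} [NormedAddCommGroup F] [NormedSpace ℝ F]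

/-! All the adjoint formulas come from one family of identities on generators, spread to the
enveloping algebra by induction on left multiplication by Lie algebra elements: `(XP)^* = -P^* X`,
so an identity for `P` gives one for `XP` as soon as moving a single `X` across costs a sign.

For the `L^2` product the sign is integration by parts: `∫ X h = 0` for `h` smooth with compact
support, because right translations preserve the measure (`integral_lieDeriv`), and the Leibniz rule
does the rest. This gives `l2Form_leftInvOp`. For distributions no integration is needed. At the
identity, `X` agrees up to sign with the corresponding right-invariant field, that field commutes
with `P`, and the involution exchanges the two kinds of field (`conj_leftInvOp_invol_one`).

The Hilbert module statements follow from the `L^2` one. In any unitary representation, `k f^*` is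
the integrated form of `t ↦ ⟨f, k ∘ l_t⟩` in `L^2` (`UnitaryRep.inner_integrated_star`), and `P`
commutes with `l_t`, so the `L^2` adjoint is the adjoint for `b a^*`. The product `a^* b` reduces to
this by the involution and reflection. The converse, that `ζ` is determined, is nondegeneracy: test
functions are dense and stable under the involution, so an `η` with `η f^* = 0` for all `f`
satisfies `η η^* = 0` (`GroupCStar.eq_zero_of_mul_eq_zero`).

For Dirac elements, `-iX` is fixed by the adjoint because conjugation and the principal
anti-automorphism each contribute a sign, and `ext e + int e` is symmetric because `int e` is the
transpose of `ext e`. A sum of tensor products of symmetric operators is symmetric for the product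
form. The orbital cosymbol is by definition such an element. -/

theorem HasMFDerivAt.hasDerivAt {f : ℝ → F} {s : ℝ}
    {T : TangentSpace 𝓘(ℝ, ℝ) s →L[ℝ] TangentSpace 𝓘(ℝ, F) (f s)}
    (h : HasMFDerivAt 𝓘(ℝ, ℝ) 𝓘(ℝ, F) f s T) : HasDerivAt f (show F from T (1 : ℝ)) s := by
  have h1 : HasFDerivAt f (show ℝ →L[ℝ] F from T) s := hasMFDerivAt_iff_hasFDerivAt.1 h
  exact h1.hasDerivAt

/-- The partial derivative of a smooth function in a real parameter is jointly smooth. -/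
theorem contMDiff_deriv_snd {N : Type*} [TopologicalSpace N] [ChartedSpace E N]
    [IsManifold 𝓘(ℝ, E) ∞ N] {ψ : N × ℝ → F}
    (hψ : ContMDiff (𝓘(ℝ, E).prod 𝓘(ℝ, ℝ)) 𝓘(ℝ, F) ∞ ψ) :
    ContMDiff (𝓘(ℝ, E).prod 𝓘(ℝ, ℝ)) 𝓘(ℝ, F) ∞
      (fun p : N × ℝ => deriv (fun s => ψ (p.1, s)) p.2) := by
  have : IsManifold 𝓘(ℝ, E) 1 N := IsManifold.of_le (n := ∞) (by simp)
  let I := 𝓘(ℝ, E)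
  let J := 𝓘(ℝ, ℝ)
  -- The partial derivative is the tangent map of `ψ` evaluated on the smooth field `(0, 1)` of `N ×
  -- ℝ`, which is assembled here from the zero section and the unit field.
  let fg : N × ℝ → TangentBundle I N := fun p ↦ Bundle.TotalSpace.mk' E p.1 0
  have sfg : ContMDiff (I.prod J) I.tangent ∞ fg :=
    (Bundle.contMDiff_zeroSection ℝ (TangentSpace I : N → Type _)).comp contMDiff_fst
  let fv : N × ℝ → TangentBundle J ℝ := fun p ↦ Bundle.TotalSpace.mk' ℝ p.2 (1 : ℝ)
  have sfv : ContMDiff (I.prod J) J.tangent ∞ fv := by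
    have h0 : ContMDiff J J.tangent ∞
        (fun s : ℝ => (Bundle.TotalSpace.mk' ℝ s (1 : ℝ) : TangentBundle J ℝ)) := by
      exact contMDiff_vectorSpace_iff_contDiff (V := fun _ : ℝ => (1 : ℝ)) |>.2 contDiff_const
    exact h0.comp contMDiff_snd
  have S₁ := sfg.prodMk sfv
  have S₂ : ContMDiff (I.tangent.prod J.tangent) (I.prod J).tangent ∞
    (equivTangentBundleProd I N J ℝ).symm := contMDiff_equivTangentBundleProd_symm
  have h1 : ContMDiff (I.prod J).tangent 𝓘(ℝ, F).tangent ∞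
      (tangentMap (I.prod J) 𝓘(ℝ, F) ψ) := hψ.contMDiff_tangentMap le_rfl
  have S := (contMDiff_snd_tangentBundle_modelSpace F 𝓘(ℝ, F)).comp ((h1.comp S₂).comp S₁)
  refine S.congr (fun p => ?_)
  obtain ⟨g, s⟩ := p
  change deriv (fun s => ψ (g, s)) s = mfderiv (I.prod J) 𝓘(ℝ, F) ψ (g, s) ((0 : E), (1 : ℝ))
  have hp := (hψ.mdifferentiableAt (x := (g, s)) (by simp)).hasMFDerivAt
  have hq : HasMFDerivAt J (I.prod J) (fun h : ℝ => (g, h)) s _ :=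
    ((contMDiff_const (c := g)).prodMk contMDiff_id).mdifferentiableAt
      (I := J) (n := ∞) (by simp) |>.hasMFDerivAt
  have hc := HasMFDerivAt.comp s hp hq
  have h5 := (HasMFDerivAt.hasDerivAt hc).deriv
  refine h5.trans ?_
  have h6 := DFunLike.congr_fun (mfderiv_prod_right (I := I) (I' := J) (x₀ := g) (y₀ := s)) (1 : ℝ)
  exact congrArg (mfderiv (I.prod J) 𝓘(ℝ, F) ψ (g, s)) h6

variable [FiniteDimensional ℝ E]
  {G : Type*} [TopologicalSpace G] [ChartedSpace E G]

/-- Every tangent vector of a manifold is the velocity of a smooth curve, defined on the whole line, with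
values in a compact set. -/
theorem exists_curve [IsManifold 𝓘(ℝ, E) ∞ G] (g : G) (X : TangentSpace 𝓘(ℝ, E) g) :
    ∃ (γ : ℝ → G) (C : Set G), ContMDiff 𝓘(ℝ, ℝ) 𝓘(ℝ, E) ∞ γ ∧ γ 0 = g ∧ IsCompact C ∧
      (∀ s, γ s ∈ C) ∧ ∀ f : G → F, MDiffAt f g →
        HasDerivAt (fun s => f (γ s)) (mvfderiv 𝓘(ℝ, E) f g X) 0 := by
  have : IsManifold 𝓘(ℝ, E) 1 G := IsManifold.of_le (n := ∞) (by simp)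
  let c := extChartAt 𝓘(ℝ, E) g
  have hc0 : c g ∈ c.target := mem_extChartAt_target g
  have hinv := isInvertible_mfderivWithin_extChartAt_symm (I := 𝓘(ℝ, E)) (x := g) hc0
  have hr : Set.range (𝓘(ℝ, E) : E → E) = Set.univ := by simp
  rw [hr, mfderivWithin_univ] at hinv
  have hbase : c.symm (c g) = g := extChartAt_to_inv g
  obtain ⟨T, hT⟩ := hinv
  let v : E := T.symm (show E from X)
  have hv : (mfderiv 𝓘(ℝ, E) 𝓘(ℝ, E) c.symm (c g) : E →L[ℝ] E) v = X := by
    refine (DFunLike.congr_fun hT v).symm.trans ?_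
    exact T.apply_symm_apply _
  have htgt : c.target ∈ nhds (c g) := extChartAt_target_mem_nhds g
  obtain ⟨δ, hδ, hsub⟩ := Metric.nhds_basis_closedBall.mem_iff.1 htgt
  let ε : ℝ := δ / (‖v‖ + 1)
  have hv1 : 0 < ‖v‖ + 1 := by positivity
  have hε : 0 < ε := div_pos hδ hv1
  -- The sine makes the line segment through `c g` bounded without changing its velocity `v` at `0`.
  -- With this `ε` the curve stays in the closed ball of radius `δ` inside the chart; the `+ 1`
  -- covers `v = 0`.
  let a : ℝ → E := fun s => c g + (ε * Real.sin (s / ε)) • v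
  have ha : ∀ s, a s ∈ Metric.closedBall (c g) δ := by
    intro s
    rw [mem_closedBall_iff_norm, add_sub_cancel_left, norm_smul, norm_mul, Real.norm_eq_abs,
      Real.norm_eq_abs, abs_of_pos hε]
    calc ε * |Real.sin (s / ε)| * ‖v‖ ≤ ε * 1 * (‖v‖ + 1) := by
          gcongr
          · exact Real.abs_sin_le_one _
          · linarith
      _ = δ := by rw [mul_one]; exact div_mul_cancel₀ _ hv1.ne'
  have has : ContDiff ℝ ∞ a := contDiff_const.add
    ((contDiff_const.mul (Real.contDiff_sin.comp (contDiff_id.div_const ε))).smul contDiff_const)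
  have ha0 : a 0 = c g := by simp [a]
  have had : HasDerivAt a v 0 := by
    have h1 : HasDerivAt (fun s : ℝ => s / ε) (1 / ε) 0 := (hasDerivAt_id 0).div_const ε
    have h2 := ((h1.sin.const_mul ε).smul_const v).const_add (c g)
    convert! h2 using 1
    simp [hε.ne']
  have hsm := contMDiffOn_extChartAt_symm (I := 𝓘(ℝ, E)) (n := ∞) g
  refine ⟨fun s => c.symm (a s), c.symm '' Metric.closedBall (c g) δ, ?_, ?_, ?_, ?_, ?_⟩
  · exact hsm.comp_contMDiff has.contMDiff fun s => hsub (ha s)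
  · simp only [ha0]; exact hbase
  · exact (isCompact_closedBall _ _).image_of_continuousOn (hsm.continuousOn.mono hsub)
  · exact fun s => ⟨_, ha s, rfl⟩
  · intro f hf
    have h1 : HasMFDerivAt 𝓘(ℝ, ℝ) 𝓘(ℝ, E) a 0 _ :=
      hasMFDerivAt_iff_hasFDerivAt.2 had.hasFDerivAt
    have h2 : MDifferentiableAt 𝓘(ℝ, E) 𝓘(ℝ, E) c.symm (a 0) := by
      rw [ha0]; exact (hsm.contMDiffAt htgt).mdifferentiableAt (by simp)
    have h3 : MDifferentiableAt 𝓘(ℝ, E) 𝓘(ℝ, F) f (c.symm (a 0)) := by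
      rw [ha0, hbase]; exact hf
    have h4 := HasMFDerivAt.comp (0 : ℝ) (h3.hasMFDerivAt.comp (a 0) h2.hasMFDerivAt) h1
    have h5 := HasMFDerivAt.hasDerivAt h4
    convert! h5 using 1
    -- The base points `a 0` and `c.symm (a 0)` equal `c g` and `g` only propositionally, so they
    -- are made variables and then substituted.
    have e : ∀ (b : E) (p : G), b = c g → p = g →
        mvfderiv 𝓘(ℝ, E) f g X = (mfderiv 𝓘(ℝ, E) 𝓘(ℝ, F) f p : E →L[ℝ] F)
          ((mfderiv 𝓘(ℝ, E) 𝓘(ℝ, E) c.symm b : E →L[ℝ] E) v) := by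
      rintro _ _ rfl rfl
      rw [hv]
      rfl
    refine (e (a 0) (c.symm (a 0)) ha0 (by rw [ha0, hbase])).trans ?_
    have : (ContinuousLinearMap.toSpanSingleton ℝ v) 1 = v := one_smul _ _
    conv_lhs => rw [← this]
    rfl

end Curves

/-! ### Invariant vector fields: commutation, inversion, integration by parts -/

section GroupCalculus

theorem deriv_deriv_comm {F : Type*} [NormedAddCommGroup F] [NormedSpace ℝ F] {ψ : ℝ × ℝ → F}
    (hψ : ContDiff ℝ ∞ ψ) (a b : ℝ) :
    deriv (fun s => deriv (fun r => ψ (r, s)) a) b =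
      deriv (fun r => deriv (fun s => ψ (r, s)) b) a := by
  have hd : ∀ p, HasFDerivAt ψ (fderiv ℝ ψ p) p := fun p =>
    (hψ.differentiable (by simp) p).hasFDerivAt
  have hd2 : HasFDerivAt (fderiv ℝ ψ) (fderiv ℝ (fderiv ℝ ψ) (a, b)) (a, b) :=
    ((hψ.fderiv_right (m := ∞) le_rfl).differentiable (by simp) _).hasFDerivAt
  have p1 : ∀ r s, HasDerivAt (fun r => ψ (r, s)) (fderiv ℝ ψ (r, s) (1, 0)) r := fun r s =>
    (hd (r, s)).comp_hasDerivAt (f := fun r => (r, s)) r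
      ((hasDerivAt_id r).prodMk (hasDerivAt_const r s))
  have p2 : ∀ r s, HasDerivAt (fun s => ψ (r, s)) (fderiv ℝ ψ (r, s) (0, 1)) s := fun r s =>
    (hd (r, s)).comp_hasDerivAt (f := fun s => (r, s)) s
      ((hasDerivAt_const s r).prodMk (hasDerivAt_id s))
  simp only [fun s => (p1 a s).deriv, fun r => (p2 r b).deriv]
  have q1 : HasDerivAt (fun s => fderiv ℝ ψ (a, s)) (fderiv ℝ (fderiv ℝ ψ) (a, b) (0, 1)) b :=
    hd2.comp_hasDerivAt (f := fun s => (a, s)) b ((hasDerivAt_const b a).prodMk (hasDerivAt_id b))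
  have q2 : HasDerivAt (fun r => fderiv ℝ ψ (r, b)) (fderiv ℝ (fderiv ℝ ψ) (a, b) (1, 0)) a :=
    hd2.comp_hasDerivAt (f := fun r => (r, b)) a ((hasDerivAt_id a).prodMk (hasDerivAt_const a b))
  have e1 := (q1.clm_apply (hasDerivAt_const b ((1, 0) : ℝ × ℝ))).deriv
  have e2 := (q2.clm_apply (hasDerivAt_const a ((0, 1) : ℝ × ℝ))).deriv
  simp only [map_zero, add_zero] at e1 e2
  rw [e1, e2]
  exact second_derivative_symmetric hd hd2 _ _

variable {E : Type*} [NormedAddCommGroup E] [NormedSpace ℝ E] [FiniteDimensional ℝ E]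
  {G : Type*} [TopologicalSpace G] [ChartedSpace E G] [Group G] [LieGroup 𝓘(ℝ, E) ∞ G]

/-- The chain rule for left translation by `g` moves every derivative to the identity, so a single
curve through `1` computes `lieDeriv X f` at all points. -/
theorem lieDeriv_eq_mvfderiv_one {F : Type*} [NormedAddCommGroup F] [NormedSpace ℝ F]
    (X : GroupLieAlgebra 𝓘(ℝ, E) G) {f : G → F} (hf : ContMDiff 𝓘(ℝ, E) 𝓘(ℝ, F) ∞ f) (g : G) :
    lieDeriv X f g = mvfderiv 𝓘(ℝ, E) (fun h => f (g * h)) 1 X := by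
  let X' : E := mfderiv 𝓘(ℝ, E) 𝓘(ℝ, E) (fun h : G => g * h) 1 X
  have hd : MDifferentiableAt 𝓘(ℝ, E) 𝓘(ℝ, F) f (g * 1) := hf.mdifferentiableAt (by simp)
  have hg : MDifferentiableAt 𝓘(ℝ, E) 𝓘(ℝ, E) (fun h : G => g * h) 1 :=
    (contMDiff_mul_left (I := 𝓘(ℝ, E)) (n := ∞)).mdifferentiableAt (by simp)
  have h3 := DFunLike.congr_fun (mfderiv_comp (I' := 𝓘(ℝ, E)) (1 : G) hd hg) X
  change _ = mfderiv 𝓘(ℝ, E) 𝓘(ℝ, F) (f ∘ fun h => g * h) 1 X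
  rw [h3]
  have h5 : ∀ a : G, a = g → mfderiv 𝓘(ℝ, E) 𝓘(ℝ, F) f g (X' : E) =
      (mfderiv 𝓘(ℝ, E) 𝓘(ℝ, F) f a (X' : E) : F) := by
    rintro _ rfl; rfl
  exact h5 (g * 1) (mul_one g)

/-- A substitute for `s ↦ exp (s X)`. -/
theorem exists_curve_lieDeriv (X : GroupLieAlgebra 𝓘(ℝ, E) G) :
    ∃ (γ : ℝ → G) (C : Set G), ContMDiff 𝓘(ℝ, ℝ) 𝓘(ℝ, E) ∞ γ ∧ γ 0 = 1 ∧ IsCompact C ∧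
      (∀ s, γ s ∈ C) ∧ ∀ f : G → ℂ, ContMDiff 𝓘(ℝ, E) 𝓘(ℝ, ℂ) ∞ f → ∀ g,
        HasDerivAt (fun s => f (g * γ s)) (lieDeriv X f g) 0 := by
  obtain ⟨γ, C, h1, h2, h3, h4, h5⟩ := exists_curve (F := ℂ) (1 : G) X
  refine ⟨γ, C, h1, h2, h3, h4, fun f hf g => ?_⟩
  rw [lieDeriv_eq_mvfderiv_one X hf]
  exact h5 (fun h => f (g * h)) ((hf.comp contMDiff_mul_left).mdifferentiableAt (by simp))

theorem lieDeriv_translate (X : GroupLieAlgebra 𝓘(ℝ, E) G) {f : G → ℂ}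
    (hf : ContMDiff 𝓘(ℝ, E) 𝓘(ℝ, ℂ) ∞ f) (y g : G) :
    lieDeriv X (fun t => f (y * t)) g = lieDeriv X f (y * g) := by
  have h : ContMDiff 𝓘(ℝ, E) 𝓘(ℝ, ℂ) ∞ (fun t => f (y * t)) := hf.comp contMDiff_mul_left
  rw [lieDeriv_eq_mvfderiv_one X hf, lieDeriv_eq_mvfderiv_one X h]
  simp only [mul_assoc]

theorem lieDeriv_conj (X : GroupLieAlgebra 𝓘(ℝ, E) G) {f : G → ℂ}
    (hf : ContMDiff 𝓘(ℝ, E) 𝓘(ℝ, ℂ) ∞ f) (g : G) :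
    lieDeriv X (fun t => starRingEnd ℂ (f t)) g = starRingEnd ℂ (lieDeriv X f g) :=
  lieDeriv_clm Complex.conjCLE.toContinuousLinearMap X hf g

theorem lieDeriv_mul (X : GroupLieAlgebra 𝓘(ℝ, E) G) {f k : G → ℂ}
    (hf : ContMDiff 𝓘(ℝ, E) 𝓘(ℝ, ℂ) ∞ f) (hk : ContMDiff 𝓘(ℝ, E) 𝓘(ℝ, ℂ) ∞ k) (g : G) :
    lieDeriv X (fun t => f t * k t) g = lieDeriv X f g * k g + f g * lieDeriv X k g := by
  obtain ⟨γ, C, -, h2, -, -, h5⟩ := exists_curve_lieDeriv X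
  have hfk : ContMDiff 𝓘(ℝ, E) 𝓘(ℝ, ℂ) ∞ (fun t => f t * k t) :=
    contDiff_mul.comp_contMDiff (hf.prodMk_space hk)
  have := (h5 _ hfk g).unique ((h5 f hf g).mul (h5 k hk g))
  simpa [h2] using this

theorem contMDiff_comp_inv {f : G → ℂ} (hf : ContMDiff 𝓘(ℝ, E) 𝓘(ℝ, ℂ) ∞ f) :
    ContMDiff 𝓘(ℝ, E) 𝓘(ℝ, ℂ) ∞ (fun t => f t⁻¹) := hf.comp (contMDiff_inv 𝓘(ℝ, E) ∞)

/-- In `f (δ(r)⁻¹ t γ(s))` the parameter `s` produces left-invariant derivatives and `r`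
right-invariant ones. Joint smoothness allows their order to be exchanged. -/
theorem contDiff_curves {f : G → ℂ} (hf : ContMDiff 𝓘(ℝ, E) 𝓘(ℝ, ℂ) ∞ f) {γ δ : ℝ → G}
    (hγ : ContMDiff 𝓘(ℝ, ℝ) 𝓘(ℝ, E) ∞ γ) (hδ : ContMDiff 𝓘(ℝ, ℝ) 𝓘(ℝ, E) ∞ δ) (t : G) :
    ContDiff ℝ ∞ (fun p : ℝ × ℝ => f ((δ p.1)⁻¹ * t * γ p.2)) := by
  rw [← contMDiff_iff_contDiff]
  have h1 : ContMDiff 𝓘(ℝ, ℝ × ℝ) 𝓘(ℝ, E) ∞ (fun p : ℝ × ℝ => δ p.1) :=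
    hδ.comp contDiff_fst.contMDiff
  have h2 : ContMDiff 𝓘(ℝ, ℝ × ℝ) 𝓘(ℝ, E) ∞ (fun p : ℝ × ℝ => γ p.2) :=
    hγ.comp contDiff_snd.contMDiff
  exact hf.comp ((h1.inv.mul contMDiff_const).mul h2)

/-- Left-invariant and right-invariant vector fields commute. -/
theorem lieDeriv_comm_right (X Y : GroupLieAlgebra 𝓘(ℝ, E) G) {f : G → ℂ}
    (hf : ContMDiff 𝓘(ℝ, E) 𝓘(ℝ, ℂ) ∞ f) (t : G) :
    lieDeriv X (fun u => lieDeriv Y (fun v => f v⁻¹) u⁻¹) t =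
      lieDeriv Y (fun u => lieDeriv X f u⁻¹) t⁻¹ := by
  obtain ⟨γ, -, hγ, hγ0, -, -, hγd⟩ := exists_curve_lieDeriv X
  obtain ⟨δ, -, hδ, hδ0, -, -, hδd⟩ := exists_curve_lieDeriv Y
  have e1 := (hγd _ (contMDiff_comp_inv (contMDiff_lieDeriv Y (contMDiff_comp_inv hf))) t).deriv
  have e2 := (hδd _ (contMDiff_comp_inv (contMDiff_lieDeriv X hf)) t⁻¹).deriv
  rw [← e1, ← e2]
  have d1 : ∀ u, lieDeriv Y (fun v => f v⁻¹) u = _ := fun u =>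
    (hδd _ (contMDiff_comp_inv hf) u).deriv.symm
  have d2 : ∀ u, lieDeriv X f u = _ := fun u => (hγd _ hf u).deriv.symm
  simp only [d1, d2, mul_inv_rev, inv_inv]
  -- Both sides are the mixed second derivative of `f (δ(r)⁻¹ t γ(s))` at the origin, taken in the
  -- two orders.
  have := deriv_deriv_comm (contDiff_curves hf hγ hδ t) 0 0
  simpa only [mul_assoc] using this

/-- The function `f (δ(r)⁻¹ δ(s))` is constant on the diagonal, so its two partial derivatives at
the origin, which are the two sides up to sign, add up to zero. -/
theorem lieDeriv_inv_one (Y : GroupLieAlgebra 𝓘(ℝ, E) G) {f : G → ℂ}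
    (hf : ContMDiff 𝓘(ℝ, E) 𝓘(ℝ, ℂ) ∞ f) :
    lieDeriv Y (fun v => f v⁻¹) 1 = -lieDeriv Y f 1 := by
  obtain ⟨δ, -, hδ, hδ0, -, -, hδd⟩ := exists_curve_lieDeriv Y
  have hc := contDiff_curves hf hδ hδ 1
  set ψ := fun p : ℝ × ℝ => f ((δ p.1)⁻¹ * 1 * δ p.2) with hψ
  have hd : HasFDerivAt ψ (fderiv ℝ ψ (0, 0)) (0, 0) :=
    (hc.differentiable (by simp) _).hasFDerivAt
  have p1 := hd.comp_hasDerivAt (f := fun r : ℝ => (r, (0 : ℝ))) 0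
      ((hasDerivAt_id 0).prodMk (hasDerivAt_const 0 0))
  have p2 := hd.comp_hasDerivAt (f := fun s : ℝ => ((0 : ℝ), s)) 0
      ((hasDerivAt_const 0 0).prodMk (hasDerivAt_id 0))
  have p3 := hd.comp_hasDerivAt (f := fun s : ℝ => (s, s)) 0
      ((hasDerivAt_id 0).prodMk (hasDerivAt_id 0))
  have q1 := hδd _ (contMDiff_comp_inv hf) 1
  have q2 := hδd _ hf 1
  have e1 : lieDeriv Y (fun v => f v⁻¹) 1 = fderiv ℝ ψ (0, 0) (1, 0) :=
    q1.unique (by simpa [hψ, hδ0, Function.comp_def] using p1)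
  have e2 : lieDeriv Y f 1 = fderiv ℝ ψ (0, 0) (0, 1) :=
    q2.unique (by simpa [hψ, hδ0, Function.comp_def] using p2)
  have e3 : fderiv ℝ ψ (0, 0) (1, 1) = 0 := by
    refine p3.unique ?_
    have : (ψ ∘ fun s : ℝ => (s, s)) = fun _ => f 1 := by
      funext s; simp [hψ]
    rw [this]
    exact hasDerivAt_const _ _
  rw [e1, e2, eq_neg_iff_add_eq_zero, ← map_add, ← e3]
  simp

variable [MeasurableSpace G] [BorelSpace G] (μ : Measure G) [IsFiniteMeasureOnCompacts μ]

open scoped Pointwise in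
/-- Left-invariant vector fields preserve a right invariant measure. -/
theorem integral_lieDeriv [T2Space G] [SecondCountableTopology G] [μ.IsMulRightInvariant]
    (X : GroupLieAlgebra 𝓘(ℝ, E) G) {f : G → ℂ}
    (hf : ContMDiff 𝓘(ℝ, E) 𝓘(ℝ, ℂ) ∞ f) (hc : HasCompactSupport f) :
    ∫ g, lieDeriv X f g ∂μ = 0 := by
  have := topologicalGroup_of_lieGroup 𝓘(ℝ, E) ∞ (G := G)
  obtain ⟨γ, C, hγ, hγ0, hC, hγC, hγd⟩ := exists_curve_lieDeriv X
  have hψ : ContMDiff (𝓘(ℝ, E).prod 𝓘(ℝ, ℝ)) 𝓘(ℝ, ℂ) ∞ (fun p : G × ℝ => f (p.1 * γ p.2)) :=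
    hf.comp (contMDiff_fst.mul (hγ.comp contMDiff_snd))
  have hφ := (contMDiff_deriv_snd hψ).continuous
  set φ : G × ℝ → ℂ := fun p => deriv (fun s => f (p.1 * γ s)) p.2 with hφdef
  have hdiff : ∀ g s, HasDerivAt (fun s => f (g * γ s)) (φ (g, s)) s := by
    intro g s
    have : ContMDiff 𝓘(ℝ, ℝ) 𝓘(ℝ, ℂ) ∞ (fun s => f (g * γ s)) :=
      hf.comp (contMDiff_const.mul hγ)
    exact ((contMDiff_iff_contDiff.1 this).differentiable (by simp) s).hasDerivAt
  -- Since `γ` takes values in the compact set `C`, this one compact set contains the supports of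
  -- all right translates `g ↦ f (g * γ s)`. A constant on it dominates the derivatives for `|s| ≤
  -- 1`.
  let K : Set G := tsupport f * C⁻¹
  have hK : IsCompact K := IsCompact.mul hc hC.inv
  have hzero : ∀ g, g ∉ K → ∀ s, f (g * γ s) = 0 := by
    intro g hg s
    by_contra hne
    exact hg ⟨g * γ s, subset_tsupport f hne, (γ s)⁻¹, Set.inv_mem_inv.2 (hγC s), by simp⟩
  obtain ⟨B, hB⟩ := (hK.prod (isCompact_closedBall (0 : ℝ) 1)).exists_bound_of_continuousOn
    hφ.continuousOn
  have hfc := hf.continuous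
  have key := hasDerivAt_integral_of_dominated_loc_of_deriv_le (μ := μ) (x₀ := (0 : ℝ))
    (F := fun s g => f (g * γ s)) (F' := fun s g => φ (g, s))
    (bound := K.indicator fun _ => B) (Metric.closedBall_mem_nhds (0 : ℝ) one_pos)
    (Filter.Eventually.of_forall fun s =>
      (hfc.comp (continuous_mul_const (γ s))).aestronglyMeasurable)
    (by simpa [hγ0] using hfc.integrable_of_hasCompactSupport hc)
    (hφ.comp (Continuous.prodMk_left 0)).aestronglyMeasurable
    (Filter.Eventually.of_forall fun g s hs => by
      by_cases hg : g ∈ K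
      · rw [Set.indicator_of_mem hg]
        exact hB (g, s) ⟨hg, hs⟩
      · rw [Set.indicator_of_notMem hg]
        have : (fun s => f (g * γ s)) = fun _ => 0 := funext (hzero g hg)
        simp [hφdef, this])
    ((integrable_indicator_iff hK.measurableSet).2
      (integrableOn_const hK.measure_lt_top.ne))
    (Filter.Eventually.of_forall fun g s _ => hdiff g s)
  -- Right invariance makes the integral independent of `s`, so its derivative at `0`, the integral
  -- of `lieDeriv X f`, vanishes.
  have h1 : (fun s : ℝ => ∫ g, f (g * γ s) ∂μ) = fun _ => ∫ g, f g ∂μ :=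
    funext fun s => integral_mul_right_eq_self f (γ s)
  have h2 := key.2
  rw [h1] at h2
  have h3 := h2.unique (hasDerivAt_const _ _)
  rw [← h3]
  refine integral_congr_ae (Filter.Eventually.of_forall fun g => ?_)
  exact (hγd f hf g).unique (hdiff g 0)

/-- Integration by parts: the integral of `X (conj f * k)` vanishes, and the Leibniz rule splits it
into the two terms. -/
theorem l2Form_deriv [T2Space G] [SecondCountableTopology G] [μ.IsMulRightInvariant]
    (X : GroupLieAlgebra 𝓘(ℝ, E) G) (f k : TestFun E G) :
    l2Form μ (TestFun.deriv X f) k = -l2Form μ f (TestFun.deriv X k) := by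
  have hcf : ContMDiff 𝓘(ℝ, E) 𝓘(ℝ, ℂ) ∞ (fun t => starRingEnd ℂ (f.1 t)) :=
    Complex.conjCLE.contDiff.comp_contMDiff f.2.1
  have hfk : ContMDiff 𝓘(ℝ, E) 𝓘(ℝ, ℂ) ∞ (fun t => starRingEnd ℂ (f.1 t) * k.1 t) :=
    contDiff_mul.comp_contMDiff (hcf.prodMk_space k.2.1)
  have h0 := integral_lieDeriv μ X hfk k.2.2.mul_left
  simp only [lieDeriv_mul X hcf k.2.1, lieDeriv_conj X f.2.1] at h0
  have h1 := integral_add (TestFun.integrable_conj_mul μ (TestFun.deriv X f) k)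
    (TestFun.integrable_conj_mul μ f (TestFun.deriv X k))
  replace h0 := h1.symm.trans h0
  exact eq_neg_of_add_eq_zero_left h0

end GroupCalculus

/-! ### Induction on the enveloping algebra and its adjoint -/

section EnvelopingInduction

attribute [local instance 100] LieRing.ofAssociativeRing

variable {L : Type*} [LieRing L] [LieAlgebra ℝ L]

/-- The lift of `L → S` to the enveloping algebra, followed by the inclusion of `S`, agrees with the
identity on `L`. By uniqueness it is the identity, so `S` is everything. -/
theorem UniversalEnvelopingAlgebra.adjoin_range_ι :
    Algebra.adjoin ℝ (Set.range (UniversalEnvelopingAlgebra.ι ℝ : L → _)) = ⊤ := by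
  let S := Algebra.adjoin ℝ (Set.range (UniversalEnvelopingAlgebra.ι ℝ : L → _))
  let f : L →ₗ⁅ℝ⁆ S :=
    { toFun := fun X => ⟨UniversalEnvelopingAlgebra.ι ℝ X, Algebra.subset_adjoin ⟨X, rfl⟩⟩
      map_add' := fun X Y => Subtype.ext (map_add _ X Y)
      map_smul' := fun c X => Subtype.ext (map_smul _ c X)
      map_lie' := fun {X Y} => Subtype.ext (LieHom.map_lie _ X Y) }
  have h : S.val.comp (UniversalEnvelopingAlgebra.lift ℝ f) = AlgHom.id ℝ _ := by
    refine UniversalEnvelopingAlgebra.hom_ext (R := ℝ) (LieHom.ext fun X => ?_)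
    change ((UniversalEnvelopingAlgebra.lift ℝ f (UniversalEnvelopingAlgebra.ι ℝ X) : S) :
      UniversalEnvelopingAlgebra ℝ L) = _
    rw [UniversalEnvelopingAlgebra.lift_ι_apply]
    rfl
  refine eq_top_iff.2 fun u _ => ?_
  have := DFunLike.congr_fun h u
  change ((UniversalEnvelopingAlgebra.lift ℝ f u : S) : UniversalEnvelopingAlgebra ℝ L) = u at this
  rw [← this]
  exact Subtype.prop _

namespace ComplexEnveloping

/-- An element of a Lie algebra, in the complexified enveloping algebra. -/
noncomputable def ofLie (X : L) : ComplexEnveloping L := 1 ⊗ₜ[ℝ] UniversalEnvelopingAlgebra.ι ℝ X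

-- Induction by left multiplication with Lie algebra elements suffices for every identity about
-- `P^*` and avoids monomials and bases.
@[elab_as_elim]
theorem induction {p : ComplexEnveloping L → Prop} (scalar : ∀ c : ℂ, p (c ⊗ₜ[ℝ] 1))
    (add : ∀ P Q, p P → p Q → p (P + Q)) (ofLie_mul : ∀ X P, p P → p (ofLie X * P))
    (P : ComplexEnveloping L) : p P := by
  -- Carrying an arbitrary right factor `v` turns the product case into a composition of two
  -- hypotheses. Quantifying over `c` lets a real scalar from `u` be absorbed into it.
  have main : ∀ u : UniversalEnvelopingAlgebra ℝ L, ∀ v : UniversalEnvelopingAlgebra ℝ L,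
      (∀ c : ℂ, p (c ⊗ₜ[ℝ] v)) → ∀ c : ℂ, p (c ⊗ₜ[ℝ] (u * v)) := by
    intro u
    have hu : u ∈ Algebra.adjoin ℝ (Set.range (UniversalEnvelopingAlgebra.ι ℝ : L → _)) := by
      rw [UniversalEnvelopingAlgebra.adjoin_range_ι]; trivial
    induction hu using Algebra.adjoin_induction with
    | mem u hu =>
      obtain ⟨X, rfl⟩ := hu
      intro v hv c
      have := ofLie_mul X _ (hv c)
      rwa [ofLie, Algebra.TensorProduct.tmul_mul_tmul, one_mul] at this
    | algebraMap r =>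
      intro v hv c
      rw [← Algebra.smul_def, TensorProduct.tmul_smul, TensorProduct.smul_tmul']
      exact hv _
    | add u u' _ _ h h' =>
      intro v hv c
      rw [add_mul, TensorProduct.tmul_add]
      exact add _ _ (h v hv c) (h' v hv c)
    | mul u u' _ _ h h' =>
      intro v hv c
      rw [mul_assoc]
      exact h _ (h' v hv) c
  induction P using TensorProduct.induction_on with
  | zero => simpa using scalar 0
  | add P Q hP hQ => exact add P Q hP hQ
  | tmul c u => simpa using main u 1 scalar c

end ComplexEnveloping

open ComplexEnveloping

theorem envAdjoint_tmul (c : ℂ) (u : UniversalEnvelopingAlgebra ℝ L) :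
    envAdjoint L (c ⊗ₜ[ℝ] u) = starRingEnd ℂ c ⊗ₜ[ℝ] (principalAnti L u).unop := rfl

theorem principalAnti_ι (X : L) :
    principalAnti L (UniversalEnvelopingAlgebra.ι ℝ X) =
      MulOpposite.op (-UniversalEnvelopingAlgebra.ι ℝ X) :=
  UniversalEnvelopingAlgebra.lift_ι_apply ..

theorem envAdjoint_ofLie_mul (X : L) (P : ComplexEnveloping L) :
    envAdjoint L (ofLie X * P) = -(envAdjoint L P * ofLie X) := by
  induction P using TensorProduct.induction_on with
  | zero => simp
  | add P Q hP hQ => rw [mul_add, map_add, hP, hQ, map_add, add_mul, neg_add]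
  | tmul c u =>
    rw [ofLie, Algebra.TensorProduct.tmul_mul_tmul, one_mul, envAdjoint_tmul, envAdjoint_tmul,
      Algebra.TensorProduct.tmul_mul_tmul, map_mul, principalAnti_ι, mul_one,
      ← TensorProduct.tmul_neg]
    simp

theorem envAdjoint_scalar (c : ℂ) :
    envAdjoint L (c ⊗ₜ[ℝ] 1) = starRingEnd ℂ c ⊗ₜ[ℝ] 1 := by
  rw [envAdjoint_tmul, map_one, MulOpposite.unop_one]

/-! ### Invariant operators, their distributions at the identity, and the `L^2` adjoint -/

variable {E : Type*} [NormedAddCommGroup E] [NormedSpace ℝ E] [FiniteDimensional ℝ E]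
  {G : Type*} [TopologicalSpace G] [ChartedSpace E G] [Group G] [LieGroup 𝓘(ℝ, E) ∞ G]
  (φ : L →ₗ⁅ℝ⁆ GroupLieAlgebra 𝓘(ℝ, E) G)

theorem leftInvOp_tmul (c : ℂ) (u : UniversalEnvelopingAlgebra ℝ L) (f : TestFun E G) :
    leftInvOp φ (c ⊗ₜ[ℝ] u) f =
      c • UniversalEnvelopingAlgebra.lift ℝ (TestFun.derivLie.comp φ) u f :=
  DFunLike.congr_fun (Algebra.TensorProduct.lift_tmul (Algebra.ofId ℂ _)
    (UniversalEnvelopingAlgebra.lift ℝ (TestFun.derivLie.comp φ))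
    (fun c _ => Algebra.commute_algebraMap_left c _) c u) f

theorem leftInvOp_ofLie (X : L) : leftInvOp φ (ofLie X) = TestFun.deriv (φ X) := by
  refine LinearMap.ext fun f => ?_
  rw [ofLie, leftInvOp_tmul, one_smul, UniversalEnvelopingAlgebra.lift_ι_apply]
  rfl

theorem leftInvOp_scalar (c : ℂ) (f : TestFun E G) : leftInvOp φ (c ⊗ₜ[ℝ] 1) f = c • f := by
  rw [leftInvOp_tmul, map_one]
  rfl

theorem leftInvOp_ofLie_mul (X : L) (P : ComplexEnveloping L) (f : TestFun E G) :
    leftInvOp φ (ofLie X * P) f = TestFun.deriv (φ X) (leftInvOp φ P f) := by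
  rw [map_mul, leftInvOp_ofLie]
  rfl

theorem leftInvOp_mul_ofLie (X : L) (P : ComplexEnveloping L) (f : TestFun E G) :
    leftInvOp φ (P * ofLie X) f = leftInvOp φ P (TestFun.deriv (φ X) f) := by
  rw [map_mul, leftInvOp_ofLie]
  rfl

theorem leftInvOp_add (P Q : ComplexEnveloping L) (f : TestFun E G) :
    leftInvOp φ (P + Q) f = leftInvOp φ P f + leftInvOp φ Q f := by
  rw [map_add]; rfl

theorem leftInvOp_neg (P : ComplexEnveloping L) (f : TestFun E G) :
    leftInvOp φ (-P) f = -leftInvOp φ P f := by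
  rw [map_neg]; rfl

theorem leftInvOp_translate (P : ComplexEnveloping L) (y : G) (f : TestFun E G) :
    leftInvOp φ P (TestFun.translate y f) = TestFun.translate y (leftInvOp φ P f) := by
  induction P using ComplexEnveloping.induction with
  | scalar c => rw [leftInvOp_scalar, leftInvOp_scalar]; rfl
  | add P Q hP hQ => rw [leftInvOp_add, leftInvOp_add, hP, hQ]; rfl
  | ofLie_mul X P hP =>
    rw [leftInvOp_ofLie_mul, leftInvOp_ofLie_mul, hP]
    exact Subtype.ext (funext fun g => lieDeriv_translate _ (TestFun.contMDiff _) y g)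

/-- The right-invariant vector field associated with `Y`. -/
noncomputable def TestFun.derivRight (Y : GroupLieAlgebra 𝓘(ℝ, E) G) : TestFun E G →ₗ[ℂ] TestFun E G :=
  TestFun.reflect ∘ₗ TestFun.deriv Y ∘ₗ TestFun.reflect

/-- Left-invariant and right-invariant fields commute, hence so does every polynomial in the
left-invariant ones with a right-invariant field. -/
theorem leftInvOp_derivRight (P : ComplexEnveloping L) (Y : GroupLieAlgebra 𝓘(ℝ, E) G)
    (f : TestFun E G) :
    leftInvOp φ P (TestFun.derivRight Y f) = TestFun.derivRight Y (leftInvOp φ P f) := by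
  induction P using ComplexEnveloping.induction with
  | scalar c => rw [leftInvOp_scalar, leftInvOp_scalar, map_smul]
  | add P Q hP hQ => rw [leftInvOp_add, leftInvOp_add, hP, hQ, map_add]
  | ofLie_mul X P hP =>
    rw [leftInvOp_ofLie_mul, leftInvOp_ofLie_mul, hP]
    exact Subtype.ext (funext fun g => lieDeriv_comm_right _ _ (TestFun.contMDiff _) g)

theorem TestFun.derivRight_one (Y : GroupLieAlgebra 𝓘(ℝ, E) G) (f : TestFun E G) :
    (TestFun.derivRight Y f).1 1 = -(TestFun.deriv Y f).1 1 := by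
  refine Eq.trans ?_ (lieDeriv_inv_one Y f.2.1)
  change lieDeriv Y (fun v => f.1 v⁻¹) (1 : G)⁻¹ = _
  rw [inv_one]

/-- Inversion exchanges left-invariant and right-invariant fields, and conjugation passes through
real fields. -/
theorem TestFun.invol_deriv (Y : GroupLieAlgebra 𝓘(ℝ, E) G) (f : TestFun E G) :
    TestFun.invol (TestFun.deriv Y f) = TestFun.derivRight Y (TestFun.invol f) := by
  refine Subtype.ext (funext fun t => ?_)
  change starRingEnd ℂ (lieDeriv Y f.1 t⁻¹) =
    lieDeriv Y (fun v => starRingEnd ℂ (f.1 v⁻¹⁻¹)) t⁻¹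
  simp only [inv_inv]
  exact (lieDeriv_conj Y f.2.1 _).symm

theorem TestFun.invol_invol (f : TestFun E G) : TestFun.invol (TestFun.invol f) = f :=
  Subtype.ext (funext fun t => by simp [TestFun.invol])

/-- This is the distributional adjoint. For `XP`, the outer `X` at the identity becomes minus the
right-invariant field, which moves past `P` and then past the involution, where it is `X` acting on
`f`. The result is the rule `(XP)^* = -P^* X`. -/
theorem conj_leftInvOp_invol_one (P : ComplexEnveloping L) (f : TestFun E G) :
    starRingEnd ℂ ((leftInvOp φ P (TestFun.invol f)).1 1) =
      (leftInvOp φ (envAdjoint L P) f).1 1 := by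
  induction P using ComplexEnveloping.induction generalizing f with
  | scalar c =>
    rw [envAdjoint_scalar, leftInvOp_scalar, leftInvOp_scalar]
    simp [TestFun.invol]
  | add P Q hP hQ =>
    rw [leftInvOp_add, map_add, leftInvOp_add, Submodule.coe_add, Submodule.coe_add, Pi.add_apply,
      Pi.add_apply, map_add, hP, hQ]
  | ofLie_mul X P hP =>
    rw [leftInvOp_ofLie_mul, envAdjoint_ofLie_mul, leftInvOp_neg, leftInvOp_mul_ofLie,
      Submodule.coe_neg, Pi.neg_apply, ← hP, TestFun.invol_deriv, leftInvOp_derivRight,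
      TestFun.derivRight_one, map_neg, neg_neg]

/-- Left invariance: evaluating `P (f ∘ l_y)` at the identity is evaluating `P f` at `y`. -/
theorem TestFun.toOp_kernelAtOne (P : ComplexEnveloping L) (f : TestFun E G) (y : G) :
    (TestFun.kernelAtOne (leftInvOp φ P)).toOp f y = (leftInvOp φ P f).1 y := by
  change (leftInvOp φ P (TestFun.translate y f)).1 1 = _
  rw [leftInvOp_translate]
  exact congrArg (leftInvOp φ P f).1 (mul_one y)

theorem TestFun.star_kernelAtOne (P : ComplexEnveloping L) :
    (TestFun.kernelAtOne (leftInvOp φ P)).star =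
      TestFun.kernelAtOne (leftInvOp φ (envAdjoint L P)) :=
  LinearMap.ext fun f => conj_leftInvOp_invol_one φ P f

variable [MeasurableSpace G] [BorelSpace G] (μ : Measure G) [IsFiniteMeasureOnCompacts μ]

theorem l2Form_smul_left (c : ℂ) (f k : TestFun E G) :
    l2Form μ (c • f) k = starRingEnd ℂ c * l2Form μ f k := by
  refine Eq.trans ?_ (integral_const_mul (starRingEnd ℂ c) _)
  exact integral_congr_ae (Filter.Eventually.of_forall fun g => by simp [mul_assoc])

theorem l2Form_smul_right (c : ℂ) (f k : TestFun E G) :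
    l2Form μ f (c • k) = c * l2Form μ f k := by
  refine Eq.trans ?_ (integral_const_mul c _)
  exact integral_congr_ae (Filter.Eventually.of_forall fun g => by simp [mul_left_comm])

/-- The formal adjoint for the `L^2` inner product. -/
theorem l2Form_leftInvOp [T2Space G] [SecondCountableTopology G] [μ.IsMulRightInvariant]
    (P : ComplexEnveloping L) (f k : TestFun E G) :
    l2Form μ (leftInvOp φ P f) k = l2Form μ f (leftInvOp φ (envAdjoint L P) k) := by
  induction P using ComplexEnveloping.induction generalizing k with
  | scalar c =>
    rw [envAdjoint_scalar, leftInvOp_scalar, leftInvOp_scalar, l2Form_smul_left, l2Form_smul_right]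
  | add P Q hP hQ =>
    rw [leftInvOp_add, map_add (envAdjoint L), leftInvOp_add, map_add, map_add,
      LinearMap.add_apply, hP, hQ]
  | ofLie_mul X P hP =>
    rw [leftInvOp_ofLie_mul, envAdjoint_ofLie_mul, leftInvOp_neg, leftInvOp_mul_ofLie,
      l2Form_deriv, hP, map_neg]

end EnvelopingInduction

/-! ### Products and nondegeneracy in the group C*-algebra -/

section CStarAdjoint

/-- A bi-invariant Haar measure is invariant under inversion. -/
theorem isInvInvariant_of_isMulRightInvariant {G : Type*} [Group G] [TopologicalSpace G]
    [IsTopologicalGroup G] [LocallyCompactSpace G] [SecondCountableTopology G]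
    [MeasurableSpace G] [BorelSpace G] (μ : Measure G) [μ.IsHaarMeasure]
    [μ.IsMulRightInvariant] : μ.IsInvInvariant := by
  constructor
  let c : ℝ≥0∞ := Measure.haarScalarFactor μ.inv μ
  -- The inverse of a right-invariant measure is left-invariant, so uniqueness of Haar measure gives
  -- the factor `c`. Inverting twice gives `c ^ 2 = 1`, read off on a compact set of finite positive
  -- measure.
  have hc : μ.inv = c • μ := Measure.isMulLeftInvariant_eq_smul μ.inv μ
  have h1 : Measure.map Inv.inv (Measure.map Inv.inv μ) = c ^ 2 • μ := by
    rw [← Measure.inv_def μ, hc, Measure.map_smul, ← Measure.inv_def μ, hc, smul_smul, pow_two]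
  have h2 : μ = c ^ 2 • μ := by
    rw [Measure.map_map continuous_inv.measurable continuous_inv.measurable] at h1
    have h3 : (Inv.inv ∘ Inv.inv : G → G) = id := by funext x; simp
    rw [h3, Measure.map_id] at h1
    exact h1
  have K : TopologicalSpace.PositiveCompacts G := Classical.arbitrary _
  have h3 : c ^ 2 * μ K = 1 ^ 2 * μ K := by
    conv_rhs => rw [h2]
    simp
  have h4 : c ^ 2 = 1 ^ 2 :=
    (ENNReal.mul_left_inj (Measure.measure_pos_of_nonempty_interior _ K.interior_nonempty).ne'
      K.isCompact.measure_lt_top.ne).1 h3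
  have h5 : c = 1 := (ENNReal.pow_right_strictMono two_ne_zero).injective h4
  rw [hc, h5, one_smul]

section Representation

variable {G : Type*} [Group G] [TopologicalSpace G]

theorem UnitaryRep.inner_apply_left (ρ : UnitaryRep G) (z : G) (a b : ρ.H) :
    inner ℂ ((ρ.U z : ρ.H →L[ℂ] ρ.H) a) b = inner ℂ a ((ρ.U z⁻¹ : ρ.H →L[ℂ] ρ.H) b) := by
  have h : (ρ.U z : ρ.H →L[ℂ] ρ.H) ((ρ.U z⁻¹ : ρ.H →L[ℂ] ρ.H) b) = b := by
    have h1 : ρ.U z * ρ.U z⁻¹ = 1 := by rw [← map_mul, mul_inv_cancel, map_one]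
    exact DFunLike.congr_fun (congrArg Subtype.val h1) b
  conv_lhs => rw [← h]
  exact ContinuousLinearMap.inner_map_map_of_mem_unitary (ρ.U z).2 _ _

theorem UnitaryRep.apply_mul (ρ : UnitaryRep G) (y z : G) (v : ρ.H) :
    (ρ.U (y * z) : ρ.H →L[ℂ] ρ.H) v =
      (ρ.U y : ρ.H →L[ℂ] ρ.H) ((ρ.U z : ρ.H →L[ℂ] ρ.H) v) := by
  rw [map_mul]; rfl

variable [MeasurableSpace G] [BorelSpace G] (μ : Measure G) [IsFiniteMeasureOnCompacts μ]

theorem UnitaryRep.inner_integrated (ρ : UnitaryRep G) (f : CompactlySupportedContinuousMap G ℂ)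
    (w v : ρ.H) : inner ℂ w (ρ.integrated μ f v) =
      ∫ g, f g * inner ℂ w ((ρ.U g : ρ.H →L[ℂ] ρ.H) v) ∂μ := by
  refine (integral_inner (𝕜 := ℂ) (ρ.integrable μ f v) w).symm.trans ?_
  exact integral_congr_ae (Filter.Eventually.of_forall fun g => inner_smul_right _ _ _)

-- Formally `k f^*` is the double integral of `k(s) conj(f(z)) U(s z⁻¹)`. The substitution `s = tz`
-- turns it into the integrated form of `t ↦ ∫ conj(f(z)) k(tz) dz`, which is the `L^2` product of
-- `f` with a left translate of `k`. This is the bridge from the `L^2` adjoint to the Hilbert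
-- modules.
open scoped Pointwise in
theorem UnitaryRep.inner_integrated_star [IsTopologicalGroup G] [T2Space G]
    [SecondCountableTopology G] [μ.IsMulRightInvariant] (ρ : UnitaryRep G)
    (f k : CompactlySupportedContinuousMap G ℂ) (w v : ρ.H) :
    inner ℂ w ((ρ.integrated μ k * star (ρ.integrated μ f)) v) =
      ∫ t, (∫ z, starRingEnd ℂ (f z) * k (t * z) ∂μ) *
        inner ℂ w ((ρ.U t : ρ.H →L[ℂ] ρ.H) v) ∂μ := by
  have hφ : Continuous fun t => inner ℂ w ((ρ.U t : ρ.H →L[ℂ] ρ.H) v) :=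
    continuous_const.inner (ρ.continuous_apply v)
  have h1 : inner ℂ w ((ρ.integrated μ k * star (ρ.integrated μ f)) v) =
      ∫ z, starRingEnd ℂ (f z) * ∫ t, k (t * z) * inner ℂ w ((ρ.U t : ρ.H →L[ℂ] ρ.H) v) ∂μ ∂μ := by
    change inner ℂ w (ρ.integrated μ k ((ρ.integrated μ f).adjoint v)) = _
    rw [← ContinuousLinearMap.adjoint_inner_left, ContinuousLinearMap.adjoint_inner_right,
      ← inner_conj_symm, ρ.inner_integrated μ, ← integral_conj]
    refine integral_congr_ae (Filter.Eventually.of_forall fun z => ?_)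
    simp only [map_mul]
    rw [inner_conj_symm, ρ.inner_apply_left, ContinuousLinearMap.adjoint_inner_left,
      ρ.inner_integrated μ]
    congr 1
    -- The substitution by `t * z` cancels the `z⁻¹` that unitarity has placed next to `v`.
    refine Eq.trans (integral_mul_right_eq_self _ z).symm ?_
    refine integral_congr_ae (Filter.Eventually.of_forall fun t => ?_)
    simp only
    rw [← ρ.apply_mul, mul_inv_cancel_right]
  rw [h1]
  simp only [← integral_const_mul, ← integral_mul_const]
  refine (integral_integral_swap_of_hasCompactSupport ?_ ?_).trans ?_
  · exact (Complex.continuous_conj.comp (f.continuous.comp continuous_fst)).mul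
      ((k.continuous.comp (continuous_snd.mul continuous_fst)).mul (hφ.comp continuous_snd))
  -- A nonzero integrand forces `z` into the support of `f` and `t = (t z) z⁻¹` into a product of
  -- compact sets.
  · refine HasCompactSupport.of_support_subset_isCompact
      ((show IsCompact (tsupport f) from f.hasCompactSupport).prod
        (IsCompact.mul (show IsCompact (tsupport k) from k.hasCompactSupport)
          (show IsCompact (tsupport f) from f.hasCompactSupport).inv)) ?_
    rintro ⟨z, t⟩ h
    have hf : f z ≠ 0 := fun h0 => h (by simp [Function.uncurry, h0])
    have hk : k (t * z) ≠ 0 := fun h0 => h (by simp [Function.uncurry, h0])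
    exact ⟨subset_tsupport f hf, t * z, subset_tsupport k hk, z⁻¹,
      Set.inv_mem_inv.2 (subset_tsupport f hf), by simp⟩
  · refine integral_congr_ae (Filter.Eventually.of_forall fun t => ?_)
    refine integral_congr_ae (Filter.Eventually.of_forall fun z => ?_)
    simp only [mul_assoc]

/-- The operator of an element of the group C*-algebra in a unitary representation. -/
noncomputable def GroupCStar.component (a : GroupCStar μ) (ρ : UnitaryRep G) : ρ.H →L[ℂ] ρ.H :=
  (show lp (fun ρ : UnitaryRep G => ρ.H →L[ℂ] ρ.H) ∞ from a.1).1 ρ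

namespace GroupCStar

variable {μ}

theorem ext_component {a b : GroupCStar μ} (h : ∀ ρ, a.component μ ρ = b.component μ ρ) :
    a = b :=
  Subtype.ext (Subtype.ext (funext h))

theorem component_mul (a b : GroupCStar μ) (ρ : UnitaryRep G) :
    (a * b).component μ ρ = a.component μ ρ * b.component μ ρ := rfl

theorem component_star (a : GroupCStar μ) (ρ : UnitaryRep G) :
    (star a).component μ ρ = star (a.component μ ρ) := rfl

variable (μ) in
theorem component_of (f : CompactlySupportedContinuousMap G ℂ) (ρ : UnitaryRep G) :
    (of μ f).component μ ρ = ρ.integrated μ f := rfl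

variable (μ) in
theorem norm_of_le (f : CompactlySupportedContinuousMap G ℂ) :
    ‖of μ f‖ ≤ ∫ g, ‖f g‖ ∂μ :=
  lp.norm_le_of_forall_le (E := fun ρ : UnitaryRep G => ρ.H →L[ℂ] ρ.H)
    (integral_nonneg fun _ => norm_nonneg _) fun ρ => ρ.norm_integrated_le μ f

/-- The products `k * f^*` in the group C*-algebra depend only on the convolution. -/
theorem of_mul_star_congr [IsTopologicalGroup G] [T2Space G]
    [SecondCountableTopology G] [μ.IsMulRightInvariant]
    {f k f' k' : CompactlySupportedContinuousMap G ℂ}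
    (h : ∀ t, ∫ z, starRingEnd ℂ (f z) * k (t * z) ∂μ =
      ∫ z, starRingEnd ℂ (f' z) * k' (t * z) ∂μ) :
    of μ k * star (of μ f) = of μ k' * star (of μ f') := by
  refine ext_component fun ρ => ContinuousLinearMap.ext fun v => ext_inner_left ℂ fun w => ?_
  rw [component_mul, component_mul, component_star, component_star, component_of, component_of,
    component_of, component_of, ρ.inner_integrated_star μ, ρ.inner_integrated_star μ]
  simp only [h]

/-- An element which annihilates a set of functions which is dense and closed under the involution
vanishes. -/
theorem eq_zero_of_mul_eq_zero {η : GroupCStar μ} (s : Set (GroupCStar μ))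
    (hs : ∀ f, of μ f ∈ closure s) (h : ∀ a ∈ s, η * a = 0) (h' : ∀ a ∈ s, η * star a = 0) :
    η = 0 := by
  have c : IsClosed {a : GroupCStar μ | η * a = 0} :=
    isClosed_eq (continuous_const.mul continuous_id) continuous_const
  have c' : IsClosed {a : GroupCStar μ | η * star a = 0} :=
    isClosed_eq (continuous_const.mul continuous_star) continuous_const
  have d : ∀ f, η * of μ f = 0 := fun f => closure_minimal h c (hs f)
  have d' : ∀ f, η * star (of μ f) = 0 := fun f => closure_minimal h' c' (hs f)
  -- The two equations are carried together because the star exchanges them. In a product, `star (x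
  -- * y)` begins with `star y`, so its equation comes from the one for `star y`.
  have e : ∀ x ∈ NonUnitalStarAlgebra.adjoin ℂ (Set.range (universalRep μ)),
      η.1 * x = 0 ∧ η.1 * star x = 0 := by
    intro x hx
    induction hx using NonUnitalStarAlgebra.adjoin_induction with
    | mem x hx =>
      obtain ⟨f, rfl⟩ := hx
      exact ⟨congrArg Subtype.val (d f), congrArg Subtype.val (d' f)⟩
    | add x y _ _ hx hy =>
      exact ⟨by rw [mul_add, hx.1, hy.1, add_zero],
        by rw [star_add, mul_add, hx.2, hy.2, add_zero]⟩
    | zero => simp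
    | mul x y _ _ hx hy =>
      exact ⟨by rw [← mul_assoc, hx.1, zero_mul],
        by rw [star_mul, ← mul_assoc, hy.2, zero_mul]⟩
    | smul r x _ hx =>
      exact ⟨by rw [mul_smul_comm, hx.1, smul_zero],
        by rw [star_smul, mul_smul_comm, hx.2, smul_zero]⟩
    | star x _ hx => exact ⟨hx.2, by rw [star_star]; exact hx.1⟩
  have cl : IsClosed {x : UniversalAlgebra G | η.1 * x = 0} :=
    isClosed_eq (continuous_const.mul continuous_id) continuous_const
  -- The element `star η` itself lies in the closed subalgebra that `η` annihilates, so `η * star η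
  -- = 0` and the C*-identity gives `η = 0`.
  have m : star η.1 ∈ {x : UniversalAlgebra G | η.1 * x = 0} :=
    closure_minimal (fun x hx => (e x hx).1) cl (star η).2
  exact Subtype.ext (CStarRing.mul_star_self_eq_zero_iff η.1 |>.1 m)

end GroupCStar

end Representation

end CStarAdjoint

/-! ### Adjoints in the left and right Hilbert modules -/

section HilbertModules

attribute [local instance 100] LieRing.ofAssociativeRing

variable {E : Type*} [NormedAddCommGroup E] [NormedSpace ℝ E] [FiniteDimensional ℝ E]
  {G : Type*} [TopologicalSpace G] [ChartedSpace E G] [Group G] [LieGroup 𝓘(ℝ, E) ∞ G]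
  [T2Space G] [SecondCountableTopology G] [MeasurableSpace G] [BorelSpace G]
  {L : Type*} [LieRing L] [LieAlgebra ℝ L] (φ : L →ₗ⁅ℝ⁆ GroupLieAlgebra 𝓘(ℝ, E) G)

open TestFun

/-- The `L^1` norm dominates the C*-norm, so uniform approximation by smooth functions supported in
the compact support of `f` is enough. -/
theorem TestFun.of_mem_closure_range_toCStar (μ : Measure G) [IsFiniteMeasureOnCompacts μ]
    (f : CompactlySupportedContinuousMap G ℂ) :
    GroupCStar.of μ f ∈ closure (Set.range (toCStar μ : TestFun E G → GroupCStar μ)) := by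
  have : LocallyCompactSpace G := Manifold.locallyCompact_of_finiteDimensional 𝓘(ℝ, E)
  have hK : IsCompact (tsupport f) := f.hasCompactSupport
  rw [Metric.mem_closure_iff]
  intro ε hε
  set m : ℝ := μ.real (tsupport f)
  have hm : 0 ≤ m := ENNReal.toReal_nonneg
  have hm1 : 0 < m + 1 := by positivity
  -- Dividing by `m + 1` instead of `m` keeps the tolerance defined when the support has measure
  -- zero and makes the final inequality strict.
  obtain ⟨k, hk, hks⟩ := f.continuous.exists_contMDiff_approx 𝓘(ℝ, E) ⊤
    (continuous_const (y := ε / (m + 1))) fun _ => div_pos hε hm1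
  let k' : TestFun E G := ⟨k, k.contMDiff, f.hasCompactSupport.mono hks⟩
  refine ⟨_, ⟨k', rfl⟩, ?_⟩
  have h1 : GroupCStar.of μ f - toCStar μ k' = GroupCStar.of μ (f - toCc k') :=
    (map_sub (GroupCStar.of μ) _ _).symm
  rw [dist_eq_norm, h1]
  refine (GroupCStar.norm_of_le μ _).trans_lt ?_
  have h2 : ∀ g, ‖(f - toCc k') g‖ ≤ (tsupport f).indicator (fun _ => ε / (m + 1)) g := by
    intro g
    change ‖f g - k g‖ ≤ _
    by_cases hg : g ∈ tsupport f
    · rw [Set.indicator_of_mem hg, ← dist_eq_norm, dist_comm]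
      exact (hk g).le
    · rw [Set.indicator_of_notMem hg, image_eq_zero_of_notMem_tsupport hg]
      have : k g = 0 := by
        by_contra h
        exact hg (subset_tsupport f (hks h))
      simp [this]
  have h3 : Integrable ((tsupport f).indicator fun _ => ε / (m + 1)) μ :=
    (integrable_indicator_iff (isClosed_tsupport f).measurableSet).2
      (integrableOn_const hK.measure_lt_top.ne)
  calc ∫ g, ‖(f - toCc k') g‖ ∂μ
      ≤ ∫ g, (tsupport f).indicator (fun _ => ε / (m + 1)) g ∂μ :=
        integral_mono_of_nonneg (Filter.Eventually.of_forall fun _ => norm_nonneg _) h3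
          (Filter.Eventually.of_forall h2)
    _ = m * (ε / (m + 1)) := by
        rw [integral_indicator_const _ (isClosed_tsupport f).measurableSet, smul_eq_mul]
    _ < (m + 1) * (ε / (m + 1)) := by
        have : 0 < ε / (m + 1) := div_pos hε hm1
        nlinarith
    _ = ε := mul_div_cancel₀ _ hm1.ne'

variable (μ : Measure G) [μ.IsHaarMeasure] [μ.IsMulRightInvariant]

/-- Taking adjoints replaces `U(z)` by `U(z⁻¹)`. The change of variable `z ↦ z⁻¹` needs no modular
factor, since a bi-invariant Haar measure is inversion invariant. -/
theorem TestFun.toCStar_invol (f : TestFun E G) : toCStar μ (invol f) = star (toCStar μ f) := by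
  have := topologicalGroup_of_lieGroup 𝓘(ℝ, E) ∞ (G := G)
  have : LocallyCompactSpace G := Manifold.locallyCompact_of_finiteDimensional 𝓘(ℝ, E)
  have := isInvInvariant_of_isMulRightInvariant μ
  refine GroupCStar.ext_component fun ρ => ContinuousLinearMap.ext fun v =>
    ext_inner_left ℂ fun w => ?_
  change inner ℂ w (ρ.integrated μ (toCc (invol f)) v) =
    inner ℂ w ((ρ.integrated μ (toCc f)).adjoint v)
  rw [ContinuousLinearMap.adjoint_inner_right, ← inner_conj_symm (ρ.integrated μ (toCc f) w),
    ρ.inner_integrated μ, ρ.inner_integrated μ, ← integral_conj, ← integral_inv_eq_self _ μ]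
  refine integral_congr_ae (Filter.Eventually.of_forall fun z => ?_)
  simp only [map_mul]
  rw [inner_conj_symm, ρ.inner_apply_left]
  change starRingEnd ℂ (f.1 z⁻¹⁻¹) * _ = _
  rw [inv_inv]
  rfl

theorem TestFun.eq_zero_of_mul_star_toCStar {η : GroupCStar μ}
    (h : ∀ f : TestFun E G, η * star (toCStar μ f) = 0) : η = 0 := by
  refine GroupCStar.eq_zero_of_mul_eq_zero
    (Set.range (toCStar μ : TestFun E G → GroupCStar μ))
    (of_mem_closure_range_toCStar μ) ?_ ?_
  · rintro _ ⟨f, rfl⟩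
    have := h (invol f)
    rwa [toCStar_invol, star_star] at this
  · rintro _ ⟨f, rfl⟩
    exact h f

/-- By `GroupCStar.of_mul_star_congr` it suffices to compare `⟨P f, k ∘ l_t⟩` with `⟨f, (P^* k) ∘
l_t⟩` in `L^2`. This is the `L^2` adjoint together with the commutation of `P^*` with `l_t`. -/
theorem TestFun.toCStar_mul_star_leftInvOp (P : ComplexEnveloping L) (f k : TestFun E G) :
    toCStar μ k * star (toCStar μ (leftInvOp φ P f)) =
      toCStar μ (leftInvOp φ (envAdjoint L P) k) * star (toCStar μ f) := by
  have := topologicalGroup_of_lieGroup 𝓘(ℝ, E) ∞ (G := G)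
  refine GroupCStar.of_mul_star_congr fun t => ?_
  have := l2Form_leftInvOp φ μ P f (translate t k)
  rw [leftInvOp_translate] at this
  exact this

theorem TestFun.star_rightInvOp_mul_toCStar (P : ComplexEnveloping L) (f k : TestFun E G) :
    star (toCStar μ (rightInvOp φ P f)) * toCStar μ k =
      star (toCStar μ f) * toCStar μ (rightInvOp φ (envAdjoint L P) k) := by
  have := topologicalGroup_of_lieGroup 𝓘(ℝ, E) ∞ (G := G)
  -- Writing the right factors as double involutions brings `a^* b` into the form `a' * star b'` of
  -- the convolution criterion.
  rw [← toCStar_invol, ← toCStar_invol, ← invol_invol k,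
    ← invol_invol (rightInvOp φ (envAdjoint L P) (invol (invol k))), toCStar_invol μ (invol k),
    toCStar_invol μ (invol (rightInvOp _ _ _)), invol_invol]
  refine GroupCStar.of_mul_star_congr fun t => ?_
  -- After reflection the operators are left-invariant again. Here the translation falls on the
  -- first argument of the `L^2` product.
  have := l2Form_leftInvOp φ μ P (translate t (reflect f)) (reflect k)
  rw [leftInvOp_translate] at this
  refine Eq.trans ?_ (this.trans ?_)
  · refine integral_congr_ae (Filter.Eventually.of_forall fun z => ?_)
    change starRingEnd ℂ (starRingEnd ℂ (k.1 z⁻¹)) *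
      starRingEnd ℂ ((leftInvOp φ P (reflect f)).1 (t * z)⁻¹⁻¹) =
      starRingEnd ℂ ((leftInvOp φ P (reflect f)).1 (t * z)) * k.1 z⁻¹
    rw [Complex.conj_conj, inv_inv, mul_comm]
  · refine integral_congr_ae (Filter.Eventually.of_forall fun z => ?_)
    change starRingEnd ℂ (f.1 (t * z)⁻¹) * (leftInvOp φ (envAdjoint L P) (reflect k)).1 z =
      starRingEnd ℂ (starRingEnd ℂ ((leftInvOp φ (envAdjoint L P) (reflect k)).1 z⁻¹⁻¹)) *
      starRingEnd ℂ (f.1 (t * z)⁻¹)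
    rw [Complex.conj_conj, inv_inv, mul_comm]

/-- The adjoint of a left-invariant operator in the left Hilbert module `C^*(G)`. -/
theorem leftInner_leftInvOp_iff (P : ComplexEnveloping L) (k : TestFun E G) (ζ : GroupCStar μ) :
    (∀ f : TestFun E G, leftInner (toCStar μ (leftInvOp φ P f)) (toCStar μ k) =
      leftInner (toCStar μ f) ζ) ↔ ζ = toCStar μ (leftInvOp φ (envAdjoint L P) k) := by
  simp only [leftInner, toCStar_mul_star_leftInvOp]
  refine ⟨fun h => ?_, fun h f => by rw [h]⟩
  refine (sub_eq_zero.1 (eq_zero_of_mul_star_toCStar μ (E := E) fun f => ?_)).symm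
  rw [sub_mul, h, sub_self]

/-- The adjoint of a right-invariant operator in the right Hilbert module `C^*(G)`. -/
theorem rightInner_rightInvOp_iff (P : ComplexEnveloping L) (k : TestFun E G)
    (ζ : GroupCStar μ) :
    (∀ f : TestFun E G, rightInner (toCStar μ (rightInvOp φ P f)) (toCStar μ k) =
      rightInner (toCStar μ f) ζ) ↔ ζ = toCStar μ (rightInvOp φ (envAdjoint L P) k) := by
  simp only [rightInner, star_rightInvOp_mul_toCStar]
  refine ⟨fun h => ?_, fun h f => by rw [h]⟩
  refine (sub_eq_zero.1 (star_eq_zero.1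
    (eq_zero_of_mul_star_toCStar μ (E := E) fun f => ?_))).symm
  -- The nondegeneracy lemma cancels on the right, so it is applied to the adjoint of the
  -- difference, with the test function replaced by its involution.
  have h' := h (invol f)
  rw [toCStar_invol, star_star] at h'
  rw [← star_mul, mul_sub, h', sub_self, star_zero]

end HilbertModules

/-! ### Exterior and interior multiplication as transposes -/

section Exterior

variable {V : Type*} [NormedAddCommGroup V] [InnerProductSpace ℝ V]

/-- The reversal in the form puts the new factor `v` last, so `int v` is the first operator to reach
`b`. -/
theorem extForm_extMul_left (v : V) (a b : ExteriorAlgebra ℝ V) :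
    extForm V (extMul v a) b = extForm V a (intMul v b) := by
  change ExteriorAlgebra.algebraMapInv (intMulHom V (CliffordAlgebra.reverse
    (ExteriorAlgebra.ι ℝ v * a)) b) = _
  rw [CliffordAlgebra.reverse.map_mul, map_mul]
  have : CliffordAlgebra.reverse (ExteriorAlgebra.ι ℝ v) = ExteriorAlgebra.ι ℝ v :=
    CliffordAlgebra.reverse_ι v
  rw [this]
  have h2 : intMulHom V (ExteriorAlgebra.ι ℝ v) = intMul v :=
    ExteriorAlgebra.lift_ι_apply ..
  rw [h2]
  rfl

theorem intMul_ι_mul (v w : V) (b : ExteriorAlgebra ℝ V) :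
    intMul v (ExteriorAlgebra.ι ℝ w * b) =
      inner ℝ v w • b - ExteriorAlgebra.ι ℝ w * intMul v b :=
  CliffordAlgebra.contractLeft_ι_mul ..

/-- Interior multiplication is the transpose of exterior multiplication. -/
theorem extForm_intMul_left (v : V) (a b : ExteriorAlgebra ℝ V) :
    extForm V (intMul v a) b = extForm V a (extMul v b) := by
  induction a using CliffordAlgebra.left_induction generalizing b with
  -- Interior multiplication kills scalars, and `v ∧ b` has no scalar part, so both sides vanish.
  | algebraMap r =>
    have h0 : intMul v (algebraMap ℝ (ExteriorAlgebra ℝ V) r) = 0 :=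
      CliffordAlgebra.contractLeft_algebraMap ..
    refine (congrArg (fun c => extForm V c b) h0).trans ?_
    change extForm V 0 b = ExteriorAlgebra.algebraMapInv (intMulHom V (CliffordAlgebra.reverse
      (algebraMap ℝ (ExteriorAlgebra ℝ V) r)) (ExteriorAlgebra.ι ℝ v * b))
    have h1 : CliffordAlgebra.reverse (algebraMap ℝ (ExteriorAlgebra ℝ V) r) =
      algebraMap ℝ (ExteriorAlgebra ℝ V) r := CliffordAlgebra.reverse.commutes r
    rw [h1, AlgHom.commutes, Module.algebraMap_end_apply, map_smul, map_mul]
    simp [ExteriorAlgebra.algebraMapInv]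
  | add x y hx hy => rw [map_add, map_add, map_add, LinearMap.add_apply, LinearMap.add_apply, hx, hy]
  | ι_mul x w hx =>
    have e : ∀ c, extForm V (CliffordAlgebra.ι 0 w * x) c = extForm V x (intMul w c) :=
      extForm_extMul_left w x
    have e' : ∀ c d, extForm V (ExteriorAlgebra.ι ℝ w * c) d = extForm V c (intMul w d) :=
      extForm_extMul_left w
    rw [e]
    have h1 := intMul_ι_mul v w x
    refine (congrArg (fun c => extForm V c b) h1).trans ?_
    -- Applying the antiderivation rule to `w ∧ x` on one side and to `v ∧ b` on the other leaves
    -- the same two terms, by the induction hypothesis and the symmetry of the inner product of `V`.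
    have h2 : intMul w (extMul v b) = _ := intMul_ι_mul w v b
    rw [h2, map_sub, map_sub, LinearMap.sub_apply, e', hx, map_smul, map_smul,
      real_inner_comm]
    rfl

theorem extForm_extMul_add_intMul (v : V) (a b : ExteriorAlgebra ℝ V) :
    extForm V ((extMul v + intMul v) a) b = extForm V a ((extMul v + intMul v) b) := by
  rw [LinearMap.add_apply, LinearMap.add_apply, map_add, map_add, LinearMap.add_apply,
    extForm_extMul_left, extForm_intMul_left, add_comm]

theorem tensorForm_tmul {D A : Type*} [AddCommGroup D] [Module ℝ D] [AddCommGroup A] [Module ℝ A]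
    (B : D →ₗ[ℝ] D →ₗ[ℝ] A) (d d' : D) (a b : ExteriorAlgebra ℝ V) :
    tensorForm B (d ⊗ₜ[ℝ] a) (d' ⊗ₜ[ℝ] b) = extForm V a b • B d d' := by
  simp [tensorForm]

/-- The tensor product of formally self-adjoint operators is formally self-adjoint. -/
theorem tensorForm_map {D A : Type*} [AddCommGroup D] [Module ℝ D] [AddCommGroup A] [Module ℝ A]
    (B : D →ₗ[ℝ] D →ₗ[ℝ] A) {T : D →ₗ[ℝ] D} (hT : ∀ d d', B (T d) d' = B d (T d'))
    {S : Module.End ℝ (ExteriorAlgebra ℝ V)}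
    (hS : ∀ a b, extForm V (S a) b = extForm V a (S b)) (f k : D ⊗[ℝ] ExteriorAlgebra ℝ V) :
    tensorForm B (TensorProduct.map T S f) k = tensorForm B f (TensorProduct.map T S k) := by
  induction f using TensorProduct.induction_on with
  | zero => simp
  | add f f' h h' => rw [map_add, map_add, map_add, LinearMap.add_apply, LinearMap.add_apply, h, h']
  | tmul d a =>
    induction k using TensorProduct.induction_on with
    | zero => simp
    | add k k' h h' => rw [map_add, map_add, map_add, h, h']
    | tmul d' b =>
      rw [TensorProduct.map_tmul, TensorProduct.map_tmul, tensorForm_tmul, tensorForm_tmul, hT, hS]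

end Exterior

/-! ### Formal self-adjointness of Dirac elements -/

section DiracElements

attribute [local instance 100] LieRing.ofAssociativeRing

open TestFun

variable {L : Type*} [LieRing L] [LieAlgebra ℝ L]
  {V : Type*} [NormedAddCommGroup V] [InnerProductSpace ℝ V] {ι : Type*} [Fintype ι]

/-- Two signs cancel: conjugation of `-i` and the principal anti-automorphism on `X`. -/
theorem envAdjoint_neg_I_tmul_ι (X : L) :
    envAdjoint L ((-Complex.I) ⊗ₜ[ℝ] UniversalEnvelopingAlgebra.ι ℝ X) =
      (-Complex.I) ⊗ₜ[ℝ] UniversalEnvelopingAlgebra.ι ℝ X := by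
  rw [envAdjoint_tmul, principalAnti_ι, MulOpposite.unop_op, TensorProduct.tmul_neg,
    ← TensorProduct.neg_tmul]
  simp

theorem matrixCoeff_tmul {R : Type*} [AddCommGroup R] [Module ℝ R] (a b : ExteriorAlgebra ℝ V)
    (r : R) (T : Module.End ℝ (ExteriorAlgebra ℝ V)) :
    matrixCoeff a b (r ⊗ₜ[ℝ] T) = extForm V a (T b) • r := by
  simp [matrixCoeff]

/-- Transposing `ext w` to `int w` and back moves the factors of `a` across one at a time, which
reduces the claim to pairing with `1`. There a product `w ∧ x` gives zero on both sides because `int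
w` kills `1`. -/
theorem extForm_isSymm (a b : ExteriorAlgebra ℝ V) : extForm V a b = extForm V b a := by
  have base : ∀ c : ExteriorAlgebra ℝ V, extForm V c 1 = extForm V 1 c := by
    intro c
    induction c using CliffordAlgebra.left_induction with
    | algebraMap r =>
      have h : (algebraMap ℝ (ExteriorAlgebra ℝ V) r) = r • 1 := Algebra.algebraMap_eq_smul_one r
      refine (congrArg (fun c => extForm V c 1) h).trans (Eq.trans ?_
        (congrArg (fun c => extForm V 1 c) h).symm)
      simp
    | add x y hx hy => rw [map_add, map_add, LinearMap.add_apply, hx, hy]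
    | ι_mul x w _ =>
      refine (extForm_extMul_left w x 1).trans (Eq.trans ?_ (extForm_intMul_left w 1 x))
      have h0 : intMul w (1 : ExteriorAlgebra ℝ V) = 0 := CliffordAlgebra.contractLeft_one ..
      rw [h0, map_zero, map_zero, LinearMap.zero_apply]
  induction a using CliffordAlgebra.left_induction generalizing b with
  | algebraMap r =>
    have h : (algebraMap ℝ (ExteriorAlgebra ℝ V) r) = r • 1 := Algebra.algebraMap_eq_smul_one r
    refine (congrArg (fun c => extForm V c b) h).trans (Eq.trans ?_
      (congrArg (fun c => extForm V b c) h).symm)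
    rw [map_smul, map_smul, LinearMap.smul_apply, base]
  | add x y hx hy => rw [map_add, map_add, LinearMap.add_apply, hx, hy]
  | ι_mul x w hx =>
    refine (extForm_extMul_left w x b).trans ((hx _).trans ?_)
    exact extForm_intMul_left w b x

theorem envAdjoint_matrixCoeff_diracElement (X : ι → L) (e : ι → V)
    (a b : ExteriorAlgebra ℝ V) :
    envAdjoint L (matrixCoeff a b (diracElement X e)) = matrixCoeff b a (diracElement X e) := by
  simp only [diracElement, map_sum]
  refine Finset.sum_congr rfl fun k _ => ?_
  rw [matrixCoeff_tmul, matrixCoeff_tmul, map_smul, envAdjoint_neg_I_tmul_ι,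
    ← extForm_extMul_add_intMul, extForm_isSymm]

/-- A sum of tensor products of formally self-adjoint operators is formally self-adjoint. -/
theorem tensorForm_sum_map {D A : Type*} [AddCommGroup D] [Module ℝ D] [AddCommGroup A]
    [Module ℝ A] (B : D →ₗ[ℝ] D →ₗ[ℝ] A) {T : ι → D →ₗ[ℝ] D}
    (hT : ∀ i d d', B (T i d) d' = B d (T i d')) {S : ι → Module.End ℝ (ExteriorAlgebra ℝ V)}
    (hS : ∀ i a b, extForm V (S i a) b = extForm V a (S i b))
    (f k : D ⊗[ℝ] ExteriorAlgebra ℝ V) :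
    tensorForm B ((∑ i, TensorProduct.map (T i) (S i)) f) k =
      tensorForm B f ((∑ i, TensorProduct.map (T i) (S i)) k) := by
  simp only [LinearMap.sum_apply, map_sum]
  exact Finset.sum_congr rfl fun i _ => tensorForm_map B (hT i) (hS i) f k

variable {E : Type*} [NormedAddCommGroup E] [NormedSpace ℝ E] [FiniteDimensional ℝ E]
  {G : Type*} [TopologicalSpace G] [ChartedSpace E G] [Group G] [LieGroup 𝓘(ℝ, E) ∞ G]
  (φ : L →ₗ⁅ℝ⁆ GroupLieAlgebra 𝓘(ℝ, E) G)

theorem matrixOp_diracElement (X : ι → L) (e : ι → V) :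
    matrixOp φ (diracElement X e) = ∑ k, TensorProduct.map
      (leftInvOpReal φ ((-Complex.I) ⊗ₜ[ℝ] UniversalEnvelopingAlgebra.ι ℝ (X k)))
      (extMul (e k) + intMul (e k)) := by
  simp only [diracElement, map_sum]
  rfl

/-- Reflection acts only on the function factor, so conjugating each tensor product by it turns the
left-invariant operator into the right-invariant one and leaves the exterior factor alone. -/
theorem matrixOpRight_diracElement (X : ι → L) (e : ι → V) :
    matrixOpRight φ (diracElement X e) = ∑ k, TensorProduct.map
      ((rightInvOp φ ((-Complex.I) ⊗ₜ[ℝ] UniversalEnvelopingAlgebra.ι ℝ (X k))).restrictScalars ℝ)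
      (extMul (e k) + intMul (e k)) := by
  rw [matrixOpRight, matrixOp_diracElement]
  refine LinearMap.ext fun f => ?_
  simp only [LinearMap.comp_apply, LinearMap.sum_apply, map_sum]
  refine Finset.sum_congr rfl fun k _ => ?_
  simp only [← LinearMap.comp_apply, ← TensorProduct.map_comp]
  rfl

/-- Dirac type elements are formally self-adjoint. -/
theorem formallySelfAdjoint_diracElement [T2Space G] [SecondCountableTopology G]
    [MeasurableSpace G] [BorelSpace G] (μ : Measure G) [μ.IsHaarMeasure]
    [μ.IsMulRightInvariant] (X : ι → L) (e : ι → V) :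
    FormallySelfAdjoint φ μ (diracElement X e) where
  envelope := envAdjoint_matrixCoeff_diracElement X e
  distribution a b := by
    rw [star_kernelAtOne, envAdjoint_matrixCoeff_diracElement]
  leftModule f k := by
    rw [matrixOp_diracElement]
    refine tensorForm_sum_map _ (fun i d d' => ?_) (fun i => extForm_extMul_add_intMul (e i)) f k
    have := toCStar_mul_star_leftInvOp φ μ
      ((-Complex.I) ⊗ₜ[ℝ] UniversalEnvelopingAlgebra.ι ℝ (X i)) d d'
    rw [envAdjoint_neg_I_tmul_ι] at this
    exact this
  rightModule f k := by
    rw [matrixOpRight_diracElement]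
    refine tensorForm_sum_map _ (fun i d d' => ?_) (fun i => extForm_extMul_add_intMul (e i)) f k
    have := star_rightInvOp_mul_toCStar φ μ
      ((-Complex.I) ⊗ₜ[ℝ] UniversalEnvelopingAlgebra.ι ℝ (X i)) d d'
    rw [envAdjoint_neg_I_tmul_ι] at this
    exact this
  l2 f k := by
    rw [matrixOp_diracElement]
    refine tensorForm_sum_map _ (fun i d d' => ?_) (fun i => extForm_extMul_add_intMul (e i)) f k
    have := l2Form_leftInvOp φ μ
      ((-Complex.I) ⊗ₜ[ℝ] UniversalEnvelopingAlgebra.ι ℝ (X i)) d d'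
    rw [envAdjoint_neg_I_tmul_ι] at this
    exact this

end DiracElements
-- The theorem for the osculating group
theorem theorem4
    {E : Type*} [NormedAddCommGroup E] [NormedSpace ℝ E] [FiniteDimensional ℝ E]
    {M : Type*} [TopologicalSpace M] [ChartedSpace E M] [IsManifold 𝓘(ℝ, E) ∞ M]
    [RiemannianBundle (fun y : M => TangentSpace 𝓘(ℝ, E) y)]
    {EK : Type*} [NormedAddCommGroup EK] [NormedSpace ℝ EK] [FiniteDimensional ℝ EK]
    {K : Type*} [TopologicalSpace K] [ChartedSpace EK K] [Group K] [LieGroup 𝓘(ℝ, EK) ∞ K]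
    [MulAction K M] [ContMDiffSMul 𝓘(ℝ, EK) 𝓘(ℝ, E) ∞ K M]
    (F : TangentFiltration E M) (x : M)
    {EG : Type*} [NormedAddCommGroup EG] [NormedSpace ℝ EG] [FiniteDimensional ℝ EG]
    {G : Type*} [TopologicalSpace G] [ChartedSpace EG G] [Group G] [LieGroup 𝓘(ℝ, EG) ∞ G]
    [T2Space G] [SecondCountableTopology G] [SimplyConnectedSpace G] [Group.IsNilpotent G]
    [MeasurableSpace G] [BorelSpace G]
    (φ : F.Gr x ≃ₗ⁅ℝ⁆ GroupLieAlgebra 𝓘(ℝ, EG) G)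
    (μ : Measure G) [μ.IsHaarMeasure] [μ.IsMulRightInvariant] :
    -- the three adjoints of an element of the enveloping algebra
    (∀ P : ComplexEnveloping (F.Gr x),
      (∀ (g : TestFun EG G) (ζ : GroupCStar μ),
        (∀ f : TestFun EG G,
          leftInner (TestFun.toCStar μ (leftInvOp φ.toLieHom P f)) (TestFun.toCStar μ g) =
            leftInner (TestFun.toCStar μ f) ζ) ↔
          ζ = TestFun.toCStar μ (leftInvOp φ.toLieHom (envAdjoint (F.Gr x) P) g)) ∧
      (∀ (g : TestFun EG G) (ζ : GroupCStar μ),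
        (∀ f : TestFun EG G,
          rightInner (TestFun.toCStar μ (rightInvOp φ.toLieHom P f)) (TestFun.toCStar μ g) =
            rightInner (TestFun.toCStar μ f) ζ) ↔
          ζ = TestFun.toCStar μ (rightInvOp φ.toLieHom (envAdjoint (F.Gr x) P) g)) ∧
      (∀ (f : TestFun EG G) (y : G),
        (TestFun.kernelAtOne (leftInvOp φ.toLieHom P)).toOp f y =
          (leftInvOp φ.toLieHom P f).1 y) ∧
      (∀ (f : TestFun EG G) (y : G),
        (TestFun.kernelAtOne (leftInvOp φ.toLieHom P)).star.toOp f y =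
          (leftInvOp φ.toLieHom (envAdjoint (F.Gr x) P) f).1 y) ∧
      (TestFun.kernelAtOne (leftInvOp φ.toLieHom P)).star =
        TestFun.kernelAtOne (leftInvOp φ.toLieHom (envAdjoint (F.Gr x) P))) ∧
    -- formal self-adjointness of Dirac type elements
    (∀ (ι : Type) [Fintype ι] (X : ι → F.Gr x) (e : ι → TangentSpace 𝓘(ℝ, E) x),
      FormallySelfAdjoint φ.toLieHom μ (diracElement X e)) ∧
    -- in particular, of the cosymbol of the orbital Dirac operator
    (∀ (ι : Type) [Fintype ι] (v : Module.Basis ι ℝ (GroupLieAlgebra 𝓘(ℝ, EK) K)) (m : ℕ)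
      (hv : ∀ k, orbitDeriv K x (v k) ∈ F.H m x) (e : ι → TangentSpace 𝓘(ℝ, E) x),
      IsPolarDual (fun k => orbitDeriv K x (v k)) e →
      FormallySelfAdjoint φ.toLieHom μ (orbitalCosymbol K F x m v hv e)) := by
  refine ⟨fun P => ⟨leftInner_leftInvOp_iff _ μ P, rightInner_rightInvOp_iff _ μ P,
    TestFun.toOp_kernelAtOne _ P, fun f y => ?_, TestFun.star_kernelAtOne _ P⟩,
    fun ι _ X e => formallySelfAdjoint_diracElement _ μ X e,
    -- The orbital cosymbol unfolds to the Dirac element of the classes of the `orbitDeriv K x (v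
    -- k)` and the covectors `e k`.
    fun ι _ v m hv e _ => formallySelfAdjoint_diracElement _ μ _ e⟩
  rw [TestFun.star_kernelAtOne, TestFun.toOp_kernelAtOne]
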